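/- Let $N\ge 0$, $R\ge 1$, and let $F_1,\dots,F_R:2^{[N]}\to\mathbb{R}$ be submodular with $F_r(\emptyset)=0$ and $F_r\ge 0$, with Lovász extensions $f_r$ and base polytopes $B_r=\{y\in\mathbb{R}^N: y(S)\le F_r(S)\ \forall S\subseteq[N],\ y([N])=F_r([N])\}$. Let $S_r$ be the set of $i\in[N]$ incident to $F_r$, i.e. $F_r(S)\ne F_r(S\cup\{i\})$ for some $S$. Assume every $i\in[N]$ lies in some $S_r$, and let $\Psi$ be the diagonal matrix with $\Psi_{ii}=|\{r: i\in S_r\}|$. Let $W$ be a positive diagonal $N\times N$ matrix and $a\in\mathbb{R}^N$. For a positive diagonal matrix $V$ put $\|x\|_V^2=\sum_i V_{ii}x_i^2$. Let $$C_r=\{(y_r,\phi_r):\phi_r\ge 0,\ y_r\in\phi_rB_r\},\qquad \mathcal C=\otimes_{r}C_r,$$ and let $\Xi$ be the set of minimizers over $(y,\phi)\in\mathcal C$ of $\|\sum_r y_r-2Wa\|_{W^{-1}}^2+\sum_r\phi_r^2$. Let $x^*$ be a minimizer over $\mathbb{R}^N$ of $\|x-a\|_W^2+\sum_r f_r(x)^2$,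 and assume $f_r(x^*)\ge 0$ for all $r$ (automatic if $F_r([N])=0$ for all $r$, i.e. if the $f_r$ are nonnegative functions). Let $\phi^*$ be the $\phi$-component of a minimizer of $\sum_r\big[\|y_r-\lambda_r\|_{\Psi W^{-1}}^2+\phi_r^2\big]$ subject to $(y,\phi)\in\mathcal C$, $\sum_r\lambda_r=2Wa$, and $\lambda_{r,i}=0$ for $i\notin S_r$. Let $$\mathcal Z=\Big\{(y,\phi):\ \sum_r y_r=2W(a-x^*),\ \phi=\phi^*,\ y_{r,i}=0\ \ \forall r,\ i\notin S_r\Big\}.$$ For a set $A$ let $d((y,\phi),A)=\inf_{(y',\phi')\in A}\big(\sum_r\|y_r-y'_r\|_{\Psi W^{-1}}^2+\|\phi-\phi'\|^2\big)^{1/2}$, and define $$\kappa_*=\sup_{p\in(\mathcal C\cup\mathcal Z)\setminus\Xi}\frac{d(p,\Xi)}{\max\{d(p,\mathcal C),\,d(p,\mathcal Z)\}}\in[0,\infty],\qquad \rho=\max_{y_r\in B_r\,\forall r}\sqrt{\textstyle\sum_r\|y_r\|_1^2},$$ $$\mu(W^{(1)},W^{(2)})=\max\Big\{\sum_i W^{(1)}_{ii}\sum_j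 \frac1{W^{(2)}_{jj}},\ \tfrac94\rho^2\sum_iW^{(1)}_{ii}+1\Big\}.$$ Then: 1. $\kappa_*^2\le 1+\mu(\Psi W^{-1},W^{-1})$; in particular $\kappa_*<\infty$. 2. Let $(y^{(k)},\phi^{(k)})_{k\ge 0}$ be the iterates of the alternating projection method: $y^{(0)}=0$, $\phi^{(0)}=0$ and, with $\alpha^{(k+1)}=2W^{-1}\sum_r y^{(k)}_r-4a$ and $A_r$ the diagonal $0/1$ matrix of $S_r$, for every $r$, $$\lambda_r^{(k+1)}=y_r^{(k)}-\tfrac12A_r\Psi^{-1}W\alpha^{(k+1)},\qquad (y_r^{(k+1)},\phi_r^{(k+1)})=\arg\min_{(y_r,\phi_r)\in C_r}\|y_r-\lambda^{(k+1)}_r\|_{\Psi W^{-1}}^2+\phi_r^2 .$$ Writing $d_k=d((y^{(k)},\phi^{(k)}),\Xi)$, for all $k\ge 0$ $$d_k\le 2d_0\Big(1-\frac1{\kappa_*^2}\Big)^k\quad\text{and}\quad d_k\le 2d_0\Big(1-\frac1{1+\mu(\Psi W^{-1},W^{-1})}\Big)^k .$$ Consequently, for every $\varepsilon>0$, $d_k\le\varepsilon$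 for every $k\ge(1+\mu(\Psi W^{-1},W^{-1}))\log(2d_0/\varepsilon)$ (if $d_0=0$, then $d_k=0$ for all $k$). 3. The constant in this iteration count is no larger than the corresponding one for randomized coordinate descent, whose count is $O(R\,\mu(W^{-1},W^{-1})\log\frac1\varepsilon)$ with contraction factor $1-\frac{2}{R[1+\mu(W^{-1},W^{-1})]}$ for the squared distance: $\mu(\Psi W^{-1},W^{-1})\le R\,\mu(W^{-1},W^{-1})$ and $1+\mu(\Psi W^{-1},W^{-1})\le R\,[1+\mu(W^{-1},W^{-1})]$. -/

import Mathlib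

open scoped ENNReal BigOperators Pointwise

namespace QDSFM

variable {N R : ℕ}

/-- Submodularity of a set function on the ground set `[N]`. -/
def IsSubmodular (F : Finset (Fin N) → ℝ) : Prop :=
  ∀ S T : Finset (Fin N), F (S ∪ T) + F (S ∩ T) ≤ F S + F T

/-- The Lovász extension. The permutation `σ` sorts the entries of `x` in descending order,
`x (σ 0) ≥ x (σ 1) ≥ ...`; the term after the last entry is `0`, so that the last summand is
`F [N] * x (σ (N - 1))`. -/
noncomputable def lovasz (F : Finset (Fin N) → ℝ) (x : Fin N → ℝ) : ℝ :=
  let σ : Equiv.Perm (Fin N) := Tuple.sort (fun i => - x i)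
  ∑ k : Fin N, F ((Finset.Iic k).image σ) *
    (x (σ k) - if h : (k : ℕ) + 1 < N then x (σ ⟨(k : ℕ) + 1, h⟩) else 0)

/-- The base polytope of `F`. -/
def basePolytope (F : Finset (Fin N) → ℝ) : Set (Fin N → ℝ) :=
  {y | (∀ S : Finset (Fin N), ∑ i ∈ S, y i ≤ F S) ∧ ∑ i, y i = F Finset.univ}

/-- The element `i` is incident to `F`. -/
def Incident (F : Finset (Fin N) → ℝ) (i : Fin N) : Prop :=
  ∃ S : Finset (Fin N), F S ≠ F (insert i S)

/-- The set `S_r` of variables incident to a function. -/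
def support (F : Finset (Fin N) → ℝ) : Set (Fin N) := {i | Incident F i}

open Classical in
/-- The `i`-th diagonal entry of `Ψ`: the number of functions to which `i` is incident. -/
noncomputable def Psi (F : Fin R → Finset (Fin N) → ℝ) (i : Fin N) : ℝ :=
  ((Finset.univ.filter (fun r : Fin R => i ∈ support (F r))).card : ℝ)

/-- Squared weighted norm. A positive diagonal matrix is given by the vector of its diagonal
entries. -/
noncomputable def wnormSq (w : Fin N → ℝ) (x : Fin N → ℝ) : ℝ := ∑ i, w i * x i ^ 2

/-- Diagonal of `W⁻¹`. -/
noncomputable def invW (W : Fin N → ℝ) : Fin N → ℝ := fun i => (W i)⁻¹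

/-- Diagonal of `Ψ W⁻¹`. -/
noncomputable def PsiInvW (F : Fin R → Finset (Fin N) → ℝ) (W : Fin N → ℝ) : Fin N → ℝ :=
  fun i => Psi F i * (W i)⁻¹

/-- Objective of the primal problem. -/
noncomputable def primalObj (F : Fin R → Finset (Fin N) → ℝ) (W a x : Fin N → ℝ) : ℝ :=
  wnormSq W (x - a) + ∑ r, lovasz (F r) x ^ 2

/-- `x` solves the primal problem. -/
def IsPrimalSolution (F : Fin R → Finset (Fin N) → ℝ) (W a x : Fin N → ℝ) : Prop :=
  ∀ z : Fin N → ℝ, primalObj F W a x ≤ primalObj F W a z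

/-- Pairs `(y, φ)` with `y = (y_r)` and `φ = (φ_r)`. -/
abbrev Pt (N R : ℕ) : Type := (Fin R → Fin N → ℝ) × (Fin R → ℝ)

/-- The cone `C_r` of a single function. -/
def coneOf (F : Finset (Fin N) → ℝ) : Set ((Fin N → ℝ) × ℝ) :=
  {p | 0 ≤ p.2 ∧ p.1 ∈ p.2 • basePolytope F}

/-- The product cone `𝒞`. -/
def prodCone (F : Fin R → Finset (Fin N) → ℝ) : Set (Pt N R) :=
  {p | ∀ r, (p.1 r, p.2 r) ∈ coneOf (F r)}

/-- Objective `g` of the dual problem. -/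
noncomputable def dualObj (W a : Fin N → ℝ) (p : Pt N R) : ℝ :=
  wnormSq (invW W) (∑ r, p.1 r - (2 : ℝ) • (W * a)) + ∑ r, p.2 r ^ 2

/-- The solution set `Ξ` of the dual problem. -/
def dualSolutions (F : Fin R → Finset (Fin N) → ℝ) (W a : Fin N → ℝ) : Set (Pt N R) :=
  {p | p ∈ prodCone F ∧ ∀ q ∈ prodCone F, dualObj W a p ≤ dualObj W a q}

/-- The affine constraint on `Λ = (λ_r)` in the best approximation form of the dual problem. -/
def lamSet (F : Fin R → Finset (Fin N) → ℝ) (W a : Fin N → ℝ) : Set (Fin R → Fin N → ℝ) :=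
  {L | ∑ r, L r = (2 : ℝ) • (W * a) ∧ ∀ r, ∀ i, i ∉ support (F r) → L r i = 0}

/-- Objective of the best approximation form of the dual problem. -/
noncomputable def approxObj (F : Fin R → Finset (Fin N) → ℝ) (W : Fin N → ℝ) (p : Pt N R)
    (L : Fin R → Fin N → ℝ) : ℝ :=
  ∑ r, (wnormSq (PsiInvW F W) (p.1 r - L r) + p.2 r ^ 2)

/-- `(y, φ, Λ)` solves the best approximation form of the dual problem. -/
def IsApproxSolution (F : Fin R → Finset (Fin N) → ℝ) (W a : Fin N → ℝ) (p : Pt N R)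
    (L : Fin R → Fin N → ℝ) : Prop :=
  p ∈ prodCone F ∧ L ∈ lamSet F W a ∧
    ∀ q ∈ prodCone F, ∀ M ∈ lamSet F W a, approxObj F W p L ≤ approxObj F W q M

/-- The affine set `𝒵`, where `xs` is the primal solution and `φs` the optimal `φ`. -/
def affineZ (F : Fin R → Finset (Fin N) → ℝ) (W a xs : Fin N → ℝ) (φs : Fin R → ℝ) :
    Set (Pt N R) :=
  {p | ∑ r, p.1 r = (2 : ℝ) • (W * (a - xs)) ∧ (∀ r, p.2 r = φs r) ∧
    ∀ r, ∀ i, i ∉ support (F r) → p.1 r i = 0}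

/-- Distance of a pair to a set of pairs in the norm
`√(∑_r ‖y_r‖_w² + ∑_r φ_r²)`, as an extended nonnegative real (it is `∞` for the empty set). -/
noncomputable def wdist (w : Fin N → ℝ) (p : Pt N R) (S : Set (Pt N R)) : ℝ≥0∞ :=
  ⨅ q ∈ S, ENNReal.ofReal
    (Real.sqrt (∑ r, wnormSq w (p.1 r - q.1 r) + ∑ r, (p.2 r - q.2 r) ^ 2))

/-- The constant `κ_*`. The supremum is taken in `[0, ∞]`, and a positive number divided by
zero is `∞` there. -/
noncomputable def kappaStar (F : Fin R → Finset (Fin N) → ℝ) (W a xs : Fin N → ℝ)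
    (φs : Fin R → ℝ) : ℝ≥0∞ :=
  ⨆ p ∈ (prodCone F ∪ affineZ F W a xs φs) \ dualSolutions F W a,
    wdist (PsiInvW F W) p (dualSolutions F W a) /
      max (wdist (PsiInvW F W) p (prodCone F)) (wdist (PsiInvW F W) p (affineZ F W a xs φs))

/-- The constant `ρ`, the maximum of `√(∑_r ‖y_r‖₁²)` over the product of base polytopes. -/
noncomputable def rho (F : Fin R → Finset (Fin N) → ℝ) : ℝ :=
  sSup {t | ∃ y : Fin R → Fin N → ℝ, (∀ r, y r ∈ basePolytope (F r)) ∧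
    t = Real.sqrt (∑ r, (∑ i, |y r i|) ^ 2)}

/-- The constant `μ(W⁽¹⁾, W⁽²⁾)`. -/
noncomputable def mu (F : Fin R → Finset (Fin N) → ℝ) (W1 W2 : Fin N → ℝ) : ℝ :=
  max ((∑ i, W1 i) * ∑ j, 1 / W2 j) (9 / 4 * rho F ^ 2 * (∑ i, W1 i) + 1)

/-- The vector `α` computed by the alternating projection method from the iterate `p`. -/
noncomputable def apAlpha (W a : Fin N → ℝ) (p : Pt N R) : Fin N → ℝ :=
  fun i => 2 * (W i)⁻¹ * (∑ r, p.1 r i) - 4 * a i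

open Classical in
/-- The vector `λ_r = y_r - (1/2) A_r Ψ⁻¹ W α`, where `A_r` is the diagonal 0/1 matrix of
`S_r`. -/
noncomputable def apLam (F : Fin R → Finset (Fin N) → ℝ) (W a : Fin N → ℝ) (p : Pt N R)
    (r : Fin R) : Fin N → ℝ :=
  fun i => p.1 r i -
    1 / 2 * (if i ∈ support (F r) then 1 else 0) * (Psi F i)⁻¹ * W i * apAlpha W a p i

/-- `p 0, p 1, ...` is the sequence of iterates of the alternating projection method, started
at `0`: each `(y_r, φ_r)` is replaced by the minimizer of `‖y_r - λ_r‖² + φ_r²` over `C_r`, in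
the norm weighted by `Ψ W⁻¹`. -/
def IsAPSequence (F : Fin R → Finset (Fin N) → ℝ) (W a : Fin N → ℝ) (p : ℕ → Pt N R) : Prop :=
  p 0 = 0 ∧ ∀ k r,
    ((p (k + 1)).1 r, (p (k + 1)).2 r) ∈ coneOf (F r) ∧
    ∀ c ∈ coneOf (F r),
      wnormSq (PsiInvW F W) ((p (k + 1)).1 r - apLam F W a (p k) r) + (p (k + 1)).2 r ^ 2 ≤
        wnormSq (PsiInvW F W) (c.1 - apLam F W a (p k) r) + c.2 ^ 2

end QDSFM

/-! The argument has three layers: an explicit description of `Ξ`, a Hoffman-type error bound, and a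
firm-contraction argument for alternating projection.

Description of `Ξ`. First-order conditions for the dual show that a solution `(y, φ)` is tied to the
primal point `x = a - W⁻¹ ∑ y_r / 2` by `φ_r = 2 max(f_r(x), 0)`, and that `x` is the unique
minimizer of the primal with each `f_r` replaced by its positive part (`dual_phi`, `posObj_growth`).
Because `f_r(x*) ≥ 0`, the given `x*` also minimizes that modified objective, so `x = x*`
(`primalOf_eq`). Hence every solution has the same `∑ y_r` and the same `φ`, and `Ξ = 𝒞 ∩ 𝒵`
(`mem_dualSolutions_iff`).

Error bound. Given a point of `𝒞`, rescale each `y_r` to the optimal `φ_r` and then correct the sum.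
Among the decompositions of the target sum, take one nearest in `ℓ¹`. Its exchange graph has no
cycle, since a cycle would give a feasible improving direction with zero total. Acyclicity and the
lattice of tight sets bound the movement through each coordinate by the imbalance of the other
coordinates (`exists_decomposition_sum_abs_le`). Cauchy–Schwarz turns this into `d(q, Ξ)² ≤ μ d(q,
𝒵)²` on `𝒞`. Projection onto `𝒵`, which shares the residual equally among incident functions, is
orthogonal; Pythagoras and Young's inequality then give the constant `1 + μ` on `𝒞 ∪ 𝒵`
(`error_bound`), which bounds `κ_*²`.

Contraction. If `z` is the projection of an iterate onto `𝒵` and `b` the next iterate, then `d(b,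
ξ)² + d(z, b)² ≤ d(z, ξ)²` for every `ξ ∈ Ξ` (`dsq_step_le`). The projection onto `𝒵` satisfies the
analogous identity. An error bound with constant `K` makes each half-step shrink the squared
distance by `1 - 1/K²`, so a full step shrinks the distance itself by that factor. The factor 2 in
the stated rates is slack. -/

namespace QDSFM

variable {N R : ℕ}

/-! ### Lovász extension and the greedy algorithm -/

/-- The first `k` elements in the order given by the permutation `σ`. -/
def prefixSet (σ : Equiv.Perm (Fin N)) (k : ℕ) : Finset (Fin N) :=
  Finset.univ.filter fun i => (σ.symm i : ℕ) < k

/-- The `k`-th value of `x` in the order given by `σ`, and `0` past the end. -/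
noncomputable def ordered (σ : Equiv.Perm (Fin N)) (x : Fin N → ℝ) (k : ℕ) : ℝ :=
  if h : k < N then x (σ ⟨k, h⟩) else 0

theorem prefixSet_zero (σ : Equiv.Perm (Fin N)) : prefixSet σ 0 = ∅ := by
  simp [prefixSet]

theorem prefixSet_top (σ : Equiv.Perm (Fin N)) : prefixSet σ N = Finset.univ := by
  simp [prefixSet]

theorem prefixSet_succ (σ : Equiv.Perm (Fin N)) {k : ℕ} (h : k < N) :
    prefixSet σ (k + 1) = insert (σ ⟨k, h⟩) (prefixSet σ k) := by
  ext i
  simp only [prefixSet, Finset.mem_filter, Finset.mem_univ, true_and, Finset.mem_insert,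
    ← Equiv.symm_apply_eq, Fin.ext_iff]
  omega

theorem notMem_prefixSet (σ : Equiv.Perm (Fin N)) {k : ℕ} (h : k < N) :
    σ ⟨k, h⟩ ∉ prefixSet σ k := by
  simp [prefixSet]

theorem image_Iic_eq_prefixSet (σ : Equiv.Perm (Fin N)) (k : Fin N) :
    (Finset.Iic k).image σ = prefixSet σ (k + 1) := by
  ext i
  simp only [prefixSet, Finset.mem_filter, Finset.mem_univ, true_and, Finset.mem_image,
    Finset.mem_Iic]
  constructor
  · rintro ⟨j, hj, rfl⟩
    have : (j : ℕ) ≤ k := hj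
    simp only [Equiv.symm_apply_apply]
    omega
  · intro h
    exact ⟨σ.symm i, Fin.le_def.2 (by omega), by simp⟩

theorem sum_range_ordered (σ : Equiv.Perm (Fin N)) (z : Fin N → ℝ) {k : ℕ} (h : k ≤ N) :
    ∑ j ∈ Finset.range k, ordered σ z j = ∑ i ∈ prefixSet σ k, z i := by
  induction k with
  | zero => simp [prefixSet_zero]
  | succ k ih =>
    rw [Finset.sum_range_succ, ih (by omega), prefixSet_succ σ (by omega),
      Finset.sum_insert (notMem_prefixSet σ _), ordered, dif_pos (by omega)]
    ring

theorem sum_mul_eq_sum_range (σ : Equiv.Perm (Fin N)) (z x : Fin N → ℝ) :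
    ∑ i, z i * x i = ∑ k ∈ Finset.range N, ordered σ z k * ordered σ x k := by
  rw [← Equiv.sum_comp σ, Finset.sum_range]
  refine Finset.sum_congr rfl fun k _ => ?_
  simp [ordered]

/-- Abel summation. -/
theorem sum_range_mul_by_prefix (n : ℕ) (z x : ℕ → ℝ) :
    ∑ k ∈ Finset.range n, z k * x k =
      ∑ k ∈ Finset.range n, (∑ j ∈ Finset.range (k + 1), z j) * (x k - x (k + 1)) +
        (∑ j ∈ Finset.range n, z j) * x n := by
  induction n with
  | zero => simp
  | succ n ih =>
    rw [Finset.sum_range_succ, ih, Finset.sum_range_succ _ n, Finset.sum_range_succ z n]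
    ring

theorem sum_mul_eq_sum_prefixSet (σ : Equiv.Perm (Fin N)) (z x : Fin N → ℝ) :
    ∑ i, z i * x i = ∑ k ∈ Finset.range N,
      (∑ i ∈ prefixSet σ (k + 1), z i) * (ordered σ x k - ordered σ x (k + 1)) := by
  rw [sum_mul_eq_sum_range σ, sum_range_mul_by_prefix]
  have : ordered σ x N = 0 := by simp [ordered]
  rw [this, mul_zero, add_zero]
  refine Finset.sum_congr rfl fun k hk => ?_
  rw [sum_range_ordered σ z (by simpa using hk)]

theorem lovasz_eq_sum_prefixSet (F : Finset (Fin N) → ℝ) (x : Fin N → ℝ) :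
    lovasz F x = ∑ k ∈ Finset.range N, F (prefixSet (Tuple.sort fun i => - x i) (k + 1)) *
      (ordered (Tuple.sort fun i => - x i) x k -
        ordered (Tuple.sort fun i => - x i) x (k + 1)) := by
  rw [Finset.sum_range]
  refine Finset.sum_congr rfl fun k _ => ?_
  rw [image_Iic_eq_prefixSet]
  simp [ordered]

theorem ordered_sort_antitone (x : Fin N → ℝ) {k : ℕ} (h : k + 1 < N) :
    ordered (Tuple.sort fun i => - x i) x (k + 1) ≤ ordered (Tuple.sort fun i => - x i) x k := by
  have hm := Tuple.monotone_sort (fun i => - x i)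
  have := hm (a := ⟨k, by omega⟩) (b := ⟨k + 1, h⟩) (by simp [Fin.le_def])
  simp only [Function.comp] at this
  simp only [ordered, h, dif_pos, show k < N by omega]
  linarith

theorem sum_mul_le_lovasz {F : Finset (Fin N) → ℝ} {z : Fin N → ℝ} (hz : z ∈ basePolytope F)
    (x : Fin N → ℝ) : ∑ i, z i * x i ≤ lovasz F x := by
  rw [lovasz_eq_sum_prefixSet, sum_mul_eq_sum_prefixSet (Tuple.sort fun i => - x i)]
  refine Finset.sum_le_sum fun k hk => ?_
  rw [Finset.mem_range] at hk
  rcases Nat.lt_or_ge (k + 1) N with h | h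
  · exact mul_le_mul_of_nonneg_right (hz.1 _) (sub_nonneg.2 (ordered_sort_antitone x h))
  -- The last increment is the smallest entry minus 0, of either sign; the equality `z([N]) =
  -- F([N])` makes the sign irrelevant.
  · obtain rfl : k + 1 = N := by omega
    rw [prefixSet_top, hz.2]

/-- The vertex of the base polytope produced by the greedy algorithm. -/
noncomputable def greedy (F : Finset (Fin N) → ℝ) (σ : Equiv.Perm (Fin N)) (i : Fin N) : ℝ :=
  F (prefixSet σ (σ.symm i + 1)) - F (prefixSet σ (σ.symm i))

theorem greedy_sum_prefixSet {F : Finset (Fin N) → ℝ} (h0 : F ∅ = 0) (σ : Equiv.Perm (Fin N))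
    {k : ℕ} (h : k ≤ N) : ∑ i ∈ prefixSet σ k, greedy F σ i = F (prefixSet σ k) := by
  induction k with
  | zero => simp [prefixSet_zero, h0]
  | succ k ih =>
    rw [prefixSet_succ σ (by omega), Finset.sum_insert (notMem_prefixSet σ _), ih (by omega),
      ← prefixSet_succ]
    simp [greedy]

theorem greedy_mem {F : Finset (Fin N) → ℝ} (hF : IsSubmodular F) (h0 : F ∅ = 0)
    (σ : Equiv.Perm (Fin N)) : greedy F σ ∈ basePolytope F := by
  refine ⟨fun S => ?_, by rw [← prefixSet_top σ, greedy_sum_prefixSet h0 σ le_rfl]⟩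
  have key : ∀ k ≤ N, ∑ i ∈ S ∩ prefixSet σ k, greedy F σ i ≤ F (S ∩ prefixSet σ k) := by
    intro k
    induction k with
    | zero => simp [prefixSet_zero, h0]
    | succ k ih =>
      intro hk
      have ih := ih (by omega)
      have hn := notMem_prefixSet σ (k := k) (by omega)
      by_cases hS : σ ⟨k, by omega⟩ ∈ S
      -- Diminishing returns: the marginal gain of the new element over the full prefix is at most
      -- its gain over the part of the prefix inside `S`.
      · have h := hF (S ∩ prefixSet σ (k + 1)) (prefixSet σ k)
        have e1 : S ∩ prefixSet σ (k + 1) ∪ prefixSet σ k = prefixSet σ (k + 1) := by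
          rw [prefixSet_succ σ (by omega)]
          ext i
          simp only [Finset.mem_union, Finset.mem_inter, Finset.mem_insert]
          constructor
          · tauto
          · rintro (rfl | h) <;> tauto
        have e2 : S ∩ prefixSet σ (k + 1) ∩ prefixSet σ k = S ∩ prefixSet σ k := by
          rw [prefixSet_succ σ (by omega)]
          ext i
          simp only [Finset.mem_inter, Finset.mem_insert]
          tauto
        rw [e1, e2] at h
        have e3 : S ∩ prefixSet σ (k + 1) = insert (σ ⟨k, by omega⟩) (S ∩ prefixSet σ k) := by
          rw [prefixSet_succ σ (by omega), Finset.inter_insert_of_mem hS]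
        have e4 : ∑ i ∈ S ∩ prefixSet σ (k + 1), greedy F σ i =
            F (prefixSet σ (k + 1)) - F (prefixSet σ k) +
              ∑ i ∈ S ∩ prefixSet σ k, greedy F σ i := by
          rw [e3, Finset.sum_insert (by simp [hn])]
          simp [greedy]
        linarith
      · rw [prefixSet_succ σ (by omega), Finset.inter_insert_of_notMem hS]
        exact ih
  simpa [prefixSet_top] using key N le_rfl

theorem exists_sum_mul_eq_lovasz {F : Finset (Fin N) → ℝ} (hF : IsSubmodular F) (h0 : F ∅ = 0)
    (x : Fin N → ℝ) : ∃ z ∈ basePolytope F, ∑ i, z i * x i = lovasz F x := by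
  refine ⟨_, greedy_mem hF h0 (Tuple.sort fun i => - x i), ?_⟩
  rw [lovasz_eq_sum_prefixSet, sum_mul_eq_sum_prefixSet (Tuple.sort fun i => - x i)]
  refine Finset.sum_congr rfl fun k hk => ?_
  rw [Finset.mem_range] at hk
  rw [greedy_sum_prefixSet h0 _ (by omega)]

theorem basePolytope_nonempty {F : Finset (Fin N) → ℝ} (hF : IsSubmodular F) (h0 : F ∅ = 0) :
    (basePolytope F).Nonempty := ⟨_, greedy_mem hF h0 1⟩

/-- Elements of a base polytope are bounded coordinatewise. -/
theorem abs_le_of_mem_basePolytope {F : Finset (Fin N) → ℝ} {z : Fin N → ℝ}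
    (hz : z ∈ basePolytope F) (i : Fin N) :
    |z i| ≤ |F {i}| + |F (Finset.univ.erase i)| + |F Finset.univ| := by
  have h1 := hz.1 {i}
  have h2 := hz.1 (Finset.univ.erase i)
  have h3 := Finset.add_sum_erase Finset.univ z (Finset.mem_univ i)
  rw [hz.2] at h3
  rw [Finset.sum_singleton] at h1
  have a1 := le_abs_self (F {i})
  have a2 := le_abs_self (F (Finset.univ.erase i))
  have a3 := neg_abs_le (F Finset.univ)
  have b1 := abs_nonneg (F {i})
  have b2 := abs_nonneg (F (Finset.univ.erase i))
  have b3 := abs_nonneg (F Finset.univ)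
  rw [abs_le]
  constructor <;> linarith

theorem isClosed_basePolytope (F : Finset (Fin N) → ℝ) : IsClosed (basePolytope F) := by
  have : basePolytope F = (⋂ S : Finset (Fin N), {y | ∑ i ∈ S, y i ≤ F S}) ∩
      {y | ∑ i, y i = F Finset.univ} := by
    ext; simp [basePolytope]
  rw [this]
  refine (isClosed_iInter fun S => isClosed_le (by fun_prop) (by fun_prop)).inter
    (isClosed_eq (by fun_prop) (by fun_prop))

theorem isCompact_basePolytope (F : Finset (Fin N) → ℝ) : IsCompact (basePolytope F) := by
  refine (isCompact_univ_pi fun i => isCompact_Icc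
    (a := -(|F {i}| + |F (Finset.univ.erase i)| + |F Finset.univ|))
    (b := |F {i}| + |F (Finset.univ.erase i)| + |F Finset.univ|)).of_isClosed_subset
    (isClosed_basePolytope F) fun z hz i _ => ?_
  exact abs_le.1 (abs_le_of_mem_basePolytope hz i)

/-! ### The cones `C_r` -/

theorem smul_mem_basePolytope_smul {F : Finset (Fin N) → ℝ} {z : Fin N → ℝ}
    (hz : z ∈ basePolytope F) {c : ℝ} (hc : 0 ≤ c) : c • z ∈ basePolytope (c • F) := by
  constructor
  · intro S
    simp only [Pi.smul_apply, smul_eq_mul, ← Finset.mul_sum]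
    exact mul_le_mul_of_nonneg_left (hz.1 S) hc
  · simp only [Pi.smul_apply, smul_eq_mul, ← Finset.mul_sum, hz.2]

theorem eq_zero_of_mem_basePolytope_zero {y : Fin N → ℝ}
    (hy : y ∈ basePolytope (0 : Finset (Fin N) → ℝ)) : y = 0 := by
  have h : ∀ i, 0 ≤ - y i := fun i => by simpa using hy.1 {i}
  have h2 : ∑ i, - y i = 0 := by simpa using hy.2
  rw [Finset.sum_eq_zero_iff_of_nonneg fun i _ => h i] at h2
  ext i
  simpa using h2 i (Finset.mem_univ i)

/-- `φ B(F)` is the base polytope of `φ F`, so that the cone is a polyhedron. -/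
theorem mem_coneOf_iff {F : Finset (Fin N) → ℝ} (hF : IsSubmodular F) (h0 : F ∅ = 0)
    {y : Fin N → ℝ} {c : ℝ} : (y, c) ∈ coneOf F ↔ 0 ≤ c ∧ y ∈ basePolytope (c • F) := by
  constructor
  · rintro ⟨hc, z, hz, h⟩
    refine ⟨hc, ?_⟩
    have h : c • z = y := h
    rw [← h]
    exact smul_mem_basePolytope_smul hz hc
  · rintro ⟨hc, hy⟩
    refine ⟨hc, ?_⟩
    -- At `c = 0` both sides reduce to `y = 0`, but only because the base polytope is nonempty.
    rcases hc.eq_or_lt with rfl | hc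
    · rw [zero_smul] at hy
      obtain ⟨z, hz⟩ := basePolytope_nonempty hF h0
      exact ⟨z, hz, by simp [eq_zero_of_mem_basePolytope_zero hy]⟩
    · refine ⟨c⁻¹ • y, ?_, by simp [smul_smul, hc.ne']⟩
      have := smul_mem_basePolytope_smul hy (inv_nonneg.2 hc.le)
      rwa [smul_smul, inv_mul_cancel₀ hc.ne', one_smul] at this

theorem IsSubmodular.smul {F : Finset (Fin N) → ℝ} (hF : IsSubmodular F) {c : ℝ} (hc : 0 ≤ c) :
    IsSubmodular (c • F) := by
  intro S T
  have := mul_le_mul_of_nonneg_left (hF S T) hc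
  simp only [Pi.smul_apply, smul_eq_mul]
  linarith

/-- The constraint at `{i}` gives `z i ≤ F ∅ = 0`; the constraint at the complement of `i`, whose
value is `F [N]`, gives `0 ≤ z i`. -/
theorem eq_zero_of_notMem_support {F : Finset (Fin N) → ℝ} (h0 : F ∅ = 0) {z : Fin N → ℝ}
    (hz : z ∈ basePolytope F) {i : Fin N} (hi : i ∉ support F) : z i = 0 := by
  have hF : ∀ S, F S = F (insert i S) := by
    simpa [support, Incident] using hi
  have h1 := hz.1 {i}
  have h2 := hz.1 (Finset.univ.erase i)
  have h3 := Finset.add_sum_erase Finset.univ z (Finset.mem_univ i)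
  have e1 := hF ∅
  have e2 := hF (Finset.univ.erase i)
  rw [Finset.insert_erase (Finset.mem_univ i)] at e2
  rw [Finset.sum_singleton] at h1
  rw [insert_empty_eq] at e1
  rw [hz.2] at h3
  linarith

theorem eq_zero_of_mem_coneOf {F : Finset (Fin N) → ℝ} (h0 : F ∅ = 0) {p : (Fin N → ℝ) × ℝ}
    (hp : p ∈ coneOf F) {i : Fin N} (hi : i ∉ support F) : p.1 i = 0 := by
  obtain ⟨-, z, hz, h⟩ := hp
  have h : p.2 • z = p.1 := h
  rw [← h, Pi.smul_apply, eq_zero_of_notMem_support h0 hz hi, smul_zero]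

theorem add_smul_mem_basePolytope {F G : Finset (Fin N) → ℝ} {y z : Fin N → ℝ}
    (hy : y ∈ basePolytope F) (hz : z ∈ basePolytope G) {s t : ℝ} (hs : 0 ≤ s) (ht : 0 ≤ t) :
    s • y + t • z ∈ basePolytope (s • F + t • G) := by
  have h1 := smul_mem_basePolytope_smul hy hs
  have h2 := smul_mem_basePolytope_smul hz ht
  constructor
  · intro S
    have a := h1.1 S
    have b := h2.1 S
    simp only [Pi.add_apply, Finset.sum_add_distrib]
    linarith
  · have a := h1.2
    have b := h2.2
    simp only [Pi.add_apply, Finset.sum_add_distrib]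
    linarith

theorem coneOf_add_smul {F : Finset (Fin N) → ℝ} (hF : IsSubmodular F) (h0 : F ∅ = 0)
    {p q : (Fin N → ℝ) × ℝ} (hp : p ∈ coneOf F) (hq : q ∈ coneOf F) {s t : ℝ} (hs : 0 ≤ s)
    (ht : 0 ≤ t) : s • p + t • q ∈ coneOf F := by
  have h1 := (mem_coneOf_iff hF h0).1 hp
  have h2 := (mem_coneOf_iff hF h0).1 hq
  refine (mem_coneOf_iff hF h0).2 ⟨?_, ?_⟩
  · have := mul_nonneg hs h1.1
    have := mul_nonneg ht h2.1
    simp only [Prod.smul_snd, smul_eq_mul]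
    linarith
  · have := add_smul_mem_basePolytope h1.2 h2.2 hs ht
    rwa [smul_smul, smul_smul, ← add_smul] at this

/-! ### Nearest decompositions and the exchange graph -/

/-- Points of a product of base polytopes with a prescribed sum. -/
def decompositions (G : Fin R → Finset (Fin N) → ℝ) (s : Fin N → ℝ) :
    Set (Fin R → Fin N → ℝ) :=
  {ξ | (∀ r, ξ r ∈ basePolytope (G r)) ∧ ∑ r, ξ r = s}

theorem isCompact_decompositions (G : Fin R → Finset (Fin N) → ℝ) (s : Fin N → ℝ) :
    IsCompact (decompositions G s) := by
  refine (isCompact_univ_pi fun r => isCompact_basePolytope (G r)).of_isClosed_subset ?_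
    fun ξ hξ r _ => hξ.1 r
  have : decompositions G s = (⋂ r, {ξ | ξ r ∈ basePolytope (G r)}) ∩ {ξ | ∑ r, ξ r = s} := by
    ext; simp [decompositions]
  rw [this]
  refine (isClosed_iInter fun r => ?_).inter (isClosed_eq (by fun_prop) (by fun_prop))
  exact (isClosed_basePolytope (G r)).preimage (continuous_apply r)

/-- Directions that keep the tight constraints at `ξ` and follow the signs of `e`. -/
def IsConformalDir (G : Fin R → Finset (Fin N) → ℝ) (ξ e d : Fin R → Fin N → ℝ) : Prop :=
  (∀ r S, ∑ i ∈ S, ξ r i = G r S → ∑ i ∈ S, d r i ≤ 0) ∧ (∀ r, ∑ i, d r i = 0) ∧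
    (∀ r i, e r i ≤ 0 → d r i ≤ 0) ∧ ∀ r i, 0 ≤ e r i → 0 ≤ d r i

theorem IsConformalDir.add {G : Fin R → Finset (Fin N) → ℝ} {ξ e d d' : Fin R → Fin N → ℝ}
    (h : IsConformalDir G ξ e d) (h' : IsConformalDir G ξ e d') :
    IsConformalDir G ξ e (d + d') := by
  refine ⟨fun r S hS => ?_, fun r => ?_, fun r i hi => ?_, fun r i hi => ?_⟩
  · simp only [Pi.add_apply, Finset.sum_add_distrib]
    linarith [h.1 r S hS, h'.1 r S hS]
  · simp only [Pi.add_apply, Finset.sum_add_distrib]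
    linarith [h.2.1 r, h'.2.1 r]
  · exact add_nonpos (h.2.2.1 r i hi) (h'.2.2.1 r i hi)
  · exact add_nonneg (h.2.2.2 r i hi) (h'.2.2.2 r i hi)

/-- A small step does not change the sign of a nonzero `e`, and for `e = 0` the two hypotheses force
`d = 0`. So the `ℓ¹` distance is exactly linear along conformal directions. -/
theorem eventually_abs_sub_mul {e d : ℝ} (h1 : e ≤ 0 → d ≤ 0) (h2 : 0 ≤ e → 0 ≤ d) :
    ∀ᶠ ε in nhdsWithin (0 : ℝ) (Set.Ioi 0), |e - ε * d| = |e| - ε * (SignType.sign e * d) := by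
  have hc : Filter.Tendsto (fun ε : ℝ => e - ε * d) (nhdsWithin 0 (Set.Ioi 0)) (nhds e) := by
    have : Continuous fun ε : ℝ => e - ε * d := by fun_prop
    simpa using (this.tendsto 0).mono_left nhdsWithin_le_nhds
  rcases lt_trichotomy e 0 with h | h | h
  · filter_upwards [hc.eventually_lt_const h] with ε hε
    rw [abs_of_neg hε, abs_of_neg h, sign_neg h]
    simp
    ring
  · have : d = 0 := le_antisymm (h1 h.le) (h2 h.ge)
    simp [this]
  · filter_upwards [hc.eventually_const_lt h] with ε hε
    rw [abs_of_pos hε, abs_of_pos h, sign_pos h]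
    simp

/-- A small step along `d` stays feasible: tight constraints do not increase, slack ones have room,
and the sums are preserved. The sum bounded here is the rate at which such a step decreases the `ℓ¹`
distance, so minimality makes it nonpositive. -/
theorem IsConformalDir.sum_sign_le_zero {G : Fin R → Finset (Fin N) → ℝ} {s : Fin N → ℝ}
    {y ξ d : Fin R → Fin N → ℝ} (hξ : ξ ∈ decompositions G s)
    (hmin : ∀ ζ ∈ decompositions G s, ∑ r, ∑ i, |y r i - ξ r i| ≤ ∑ r, ∑ i, |y r i - ζ r i|)
    (hd : IsConformalDir G ξ (y - ξ) d) (hsum : ∑ r, d r = 0) :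
    ∑ r, ∑ i, (SignType.sign ((y - ξ) r i) : ℝ) * d r i ≤ 0 := by
  have h1 : ∀ᶠ ε in nhdsWithin (0 : ℝ) (Set.Ioi 0), ∀ r S,
      ∑ i ∈ S, (ξ r i + ε * d r i) ≤ G r S := by
    refine Filter.eventually_all.2 fun r => Filter.eventually_all.2 fun S => ?_
    rcases (hξ.1 r).1 S |>.eq_or_lt with h | h
    · filter_upwards [self_mem_nhdsWithin] with ε hε
      rw [Finset.sum_add_distrib, ← Finset.mul_sum, h]
      have := mul_nonpos_of_nonneg_of_nonpos (le_of_lt (Set.mem_Ioi.1 hε)) (hd.1 r S h)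
      linarith
    · have hc : Continuous fun ε : ℝ => ∑ i ∈ S, (ξ r i + ε * d r i) := by fun_prop
      have := (hc.tendsto 0).mono_left (nhdsWithin_le_nhds (s := Set.Ioi 0))
      simp only [zero_mul, add_zero] at this
      exact (this.eventually_lt_const h).mono fun ε hε => hε.le
  have h2 : ∀ᶠ ε in nhdsWithin (0 : ℝ) (Set.Ioi 0), ∀ r i, |(y - ξ) r i - ε * d r i| =
      |(y - ξ) r i| - ε * (SignType.sign ((y - ξ) r i) * d r i) :=
    Filter.eventually_all.2 fun r => Filter.eventually_all.2 fun i =>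
      eventually_abs_sub_mul (hd.2.2.1 r i) (hd.2.2.2 r i)
  obtain ⟨ε, ⟨h1, h2⟩, hε⟩ := ((h1.and h2).and self_mem_nhdsWithin).exists
  have hε : 0 < ε := hε
  have hmem : ξ + ε • d ∈ decompositions G s := by
    refine ⟨fun r => ⟨h1 r, ?_⟩, ?_⟩
    · have a := hd.2.1 r
      have b := (hξ.1 r).2
      simp [Finset.sum_add_distrib, ← Finset.mul_sum, a, b]
    · simp [Finset.sum_add_distrib, ← Finset.smul_sum, hsum, hξ.2]
  have := hmin _ hmem
  have e : ∑ r, ∑ i, |y r i - (ξ + ε • d) r i| = ∑ r, ∑ i, |y r i - ξ r i| -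
      ε * ∑ r, ∑ i, (SignType.sign ((y - ξ) r i) : ℝ) * d r i := by
    simp only [Finset.mul_sum, ← Finset.sum_sub_distrib]
    refine Finset.sum_congr rfl fun r _ => Finset.sum_congr rfl fun i _ => ?_
    refine Eq.trans ?_ (h2 r i)
    congr 1
    simp
    ring
  rw [e] at this
  have h3 : ε * ∑ r, ∑ i, (SignType.sign ((y - ξ) r i) : ℝ) * d r i ≤ 0 := by linarith
  exact nonpos_of_mul_nonpos_right h3 hε

/-- `i → j` in the exchange graph: some component can trade `j` for `i` and get closer to its
target. -/
def ExchangeEdge (G : Fin R → Finset (Fin N) → ℝ) (ξ e : Fin R → Fin N → ℝ) (i j : Fin N) :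
    Prop :=
  ∃ r, 0 < e r i ∧ e r j < 0 ∧ ∀ S, ∑ k ∈ S, ξ r k = G r S → i ∈ S → j ∈ S

theorem ExchangeEdge.exists_dir {G : Fin R → Finset (Fin N) → ℝ} {ξ e : Fin R → Fin N → ℝ}
    {i j : Fin N} (h : ExchangeEdge G ξ e i j) :
    ∃ d, IsConformalDir G ξ e d ∧ ∑ r, d r = Pi.single i 1 - Pi.single j 1 ∧
      0 < ∑ r, ∑ k, (SignType.sign (e r k) : ℝ) * d r k := by
  obtain ⟨r, hi, hj, hS⟩ := h
  have hij : i ≠ j := by rintro rfl; linarith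
  refine ⟨Pi.single r (Pi.single i 1 - Pi.single j 1), ⟨fun r' S hr' => ?_, fun r' => ?_,
    fun r' k hk => ?_, fun r' k hk => ?_⟩, ?_, ?_⟩
  · rcases eq_or_ne r' r with rfl | hne
    · simp only [Pi.single_eq_same, Pi.sub_apply, Finset.sum_sub_distrib, Pi.single_apply,
        Finset.sum_ite_eq']
      have := hS S hr'
      split_ifs <;> simp_all
    · simp [hne]
  · rcases eq_or_ne r' r with rfl | hne
    · simp
    · simp [hne]
  · rcases eq_or_ne r' r with rfl | hne
    · have : k ≠ i := by rintro rfl; linarith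
      simp only [Pi.single_eq_same, Pi.sub_apply, Pi.single_eq_of_ne this]
      rcases eq_or_ne k j with rfl | hkj
      · simp
      · simp [hkj]
    · simp [hne]
  · rcases eq_or_ne r' r with rfl | hne
    · have : k ≠ j := by rintro rfl; linarith
      simp only [Pi.single_eq_same, Pi.sub_apply, Pi.single_eq_of_ne this]
      rcases eq_or_ne k i with rfl | hki
      · simp
      · simp [hki]
    · simp [hne]
  · rw [Finset.sum_eq_single r (by intro b _ hb; simp [hb]) (by simp), Pi.single_eq_same]
  · rw [Finset.sum_eq_single r (by intro b _ hb; simp [hb]) (by simp)]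
    simp only [Pi.single_eq_same, Pi.sub_apply, mul_sub, Finset.sum_sub_distrib]
    simp [Pi.single_apply, sign_pos hi, sign_neg hj]

/-- Conformal directions are closed under addition, so the single-edge trades of a path can be added
even when they use the same component; their totals telescope and their gains accumulate. -/
theorem exists_dir_of_transGen {G : Fin R → Finset (Fin N) → ℝ} {ξ e : Fin R → Fin N → ℝ}
    {i j : Fin N} (h : Relation.TransGen (ExchangeEdge G ξ e) i j) :
    ∃ d, IsConformalDir G ξ e d ∧ ∑ r, d r = Pi.single i 1 - Pi.single j 1 ∧
      0 < ∑ r, ∑ k, (SignType.sign (e r k) : ℝ) * d r k := by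
  induction h with
  | single h => exact h.exists_dir
  | tail _ h ih =>
    obtain ⟨d, hd, hs, hp⟩ := ih
    obtain ⟨d', hd', hs', hp'⟩ := h.exists_dir
    refine ⟨d + d', hd.add hd', ?_, ?_⟩
    · simp only [Pi.add_apply, Finset.sum_add_distrib, hs, hs']
      abel
    · simp only [Pi.add_apply, mul_add, Finset.sum_add_distrib]
      linarith

theorem not_transGen_self {G : Fin R → Finset (Fin N) → ℝ} {s : Fin N → ℝ}
    {y ξ : Fin R → Fin N → ℝ} (hξ : ξ ∈ decompositions G s)
    (hmin : ∀ ζ ∈ decompositions G s, ∑ r, ∑ i, |y r i - ξ r i| ≤ ∑ r, ∑ i, |y r i - ζ r i|)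
    (i : Fin N) : ¬ Relation.TransGen (ExchangeEdge G ξ (y - ξ)) i i := by
  intro h
  obtain ⟨d, hd, hs, hp⟩ := exists_dir_of_transGen h
  rw [sub_self] at hs
  exact absurd (hd.sum_sign_le_zero hξ hmin hs) (not_le.2 hp)

/-! ### Tight sets and the coordinatewise decomposition bound -/

/-- Sets on which the constraint of the base polytope is tight. -/
def Tight (F : Finset (Fin N) → ℝ) (z : Fin N → ℝ) (S : Finset (Fin N)) : Prop :=
  ∑ i ∈ S, z i = F S

/-- Submodularity bounds `F(S ∪ T) + F(S ∩ T)` by `z(S ∪ T) + z(S ∩ T)`, while each term of `F`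
dominates that of `z`; both inequalities must be equalities. -/
theorem Tight.union_inter {F : Finset (Fin N) → ℝ} (hF : IsSubmodular F) {z : Fin N → ℝ}
    (hz : z ∈ basePolytope F) {S T : Finset (Fin N)} (hS : Tight F z S) (hT : Tight F z T) :
    Tight F z (S ∪ T) ∧ Tight F z (S ∩ T) := by
  have h := hF S T
  have h1 := hz.1 (S ∪ T)
  have h2 := hz.1 (S ∩ T)
  have h3 := Finset.sum_union_inter (s₁ := S) (s₂ := T) (f := z)
  unfold Tight at *
  constructor <;> linarith

open Classical in
/-- The smallest tight set containing `k`. -/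
noncomputable def tightHull (F : Finset (Fin N) → ℝ) (z : Fin N → ℝ) (k : Fin N) :
    Finset (Fin N) :=
  (Finset.univ.filter fun S => Tight F z S ∧ k ∈ S).inf id

theorem tight_tightHull {F : Finset (Fin N) → ℝ} (hF : IsSubmodular F) {z : Fin N → ℝ}
    (hz : z ∈ basePolytope F) (k : Fin N) : Tight F z (tightHull F z k) := by
  classical
  refine Finset.inf_induction (p := Tight F z) hz.2 (fun S hS T hT => ?_) fun S hS => ?_
  · exact (hS.union_inter hF hz hT).2
  · simp only [Finset.mem_filter] at hS
    exact hS.2.1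

theorem self_mem_tightHull (F : Finset (Fin N) → ℝ) (z : Fin N → ℝ) (k : Fin N) :
    k ∈ tightHull F z k := by
  classical
  have : ({k} : Finset (Fin N)) ≤ tightHull F z k := by
    refine Finset.le_inf fun S hS => ?_
    simp only [Finset.mem_filter] at hS
    simpa using hS.2.2
  exact this (by simp)

theorem tightHull_subset {F : Finset (Fin N) → ℝ} {z : Fin N → ℝ} {k : Fin N}
    {S : Finset (Fin N)} (hS : Tight F z S) (hk : k ∈ S) : tightHull F z k ⊆ S := by
  classical
  have : tightHull F z k ≤ id S := Finset.inf_le (by simp [hS, hk])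
  exact this

theorem tight_sup_tightHull {F : Finset (Fin N) → ℝ} (hF : IsSubmodular F) (h0 : F ∅ = 0)
    {z : Fin N → ℝ} (hz : z ∈ basePolytope F) (P : Finset (Fin N)) :
    Tight F z (P.sup (tightHull F z)) := by
  refine Finset.sup_induction (p := Tight F z) ?_ (fun S hS T hT => ?_) fun k _ => ?_
  · simp [Tight, h0]
  · exact (hS.union_inter hF hz hT).1
  · exact tight_tightHull hF hz k

/-- In an acyclic exchange graph the total movement through `i` is at most the total imbalance
outside `i`. -/
theorem sum_abs_le_of_acyclic {G : Fin R → Finset (Fin N) → ℝ} (hG : ∀ r, IsSubmodular (G r))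
    (h0 : ∀ r, G r ∅ = 0) {y ξ : Fin R → Fin N → ℝ} (hy : ∀ r, y r ∈ basePolytope (G r))
    (hξ : ∀ r, ξ r ∈ basePolytope (G r)) {i : Fin N}
    (hi : ¬ Relation.TransGen (ExchangeEdge G ξ (y - ξ)) i i) :
    ∑ r, |y r i - ξ r i| ≤ ∑ j ∈ Finset.univ.erase i, |∑ r, (y r j - ξ r j)| := by
  classical
  set E := ExchangeEdge G ξ (y - ξ) with hE
  set U : Finset (Fin N) := Finset.univ.filter fun j => Relation.ReflTransGen E i j with hU
  -- Compare with the sum of `y r - ξ r` over a tight set `D`, which is nonpositive. `D` contains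
  -- every element of `U` with positive difference; its elements with negative difference are
  -- reachable from `i` by an edge, so they lie in `U`, and acyclicity excludes `i` itself.
  have key : ∀ r, max (y r i - ξ r i) 0 + ∑ j ∈ U.erase i, (y r j - ξ r j) ≤ 0 := by
    intro r
    set P := U.filter fun k => 0 < y r k - ξ r k with hP
    set D := P.sup (tightHull (G r) (ξ r)) with hD
    have hPD : ∀ k ∈ P, k ∈ D := fun k hk =>
      (Finset.le_sup (f := tightHull (G r) (ξ r)) hk) (self_mem_tightHull _ _ k)
    have hneg : ∀ j ∈ D, y r j - ξ r j < 0 → j ∈ U ∧ j ≠ i := by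
      intro j hj hlt
      rw [hD, Finset.mem_sup] at hj
      obtain ⟨k, hk, hjk⟩ := hj
      simp only [hP, hU, Finset.mem_filter, Finset.mem_univ, true_and] at hk
      have hedge : E k j := ⟨r, hk.2, hlt, fun S hS hkS => tightHull_subset hS hkS hjk⟩
      refine ⟨by simpa [hU] using hk.1.tail hedge, ?_⟩
      rintro rfl
      exact hi (Relation.TransGen.tail' hk.1 hedge)
    have hDle : ∑ j ∈ D, (y r j - ξ r j) ≤ 0 := by
      have h1 := tight_sup_tightHull (hG r) (h0 r) (hξ r) P
      rw [← hD, Tight] at h1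
      rw [Finset.sum_sub_distrib, h1]
      linarith [(hy r).1 D]
    refine le_trans ?_ hDle
    have e1 : ∑ j ∈ U.erase i, (y r j - ξ r j) =
        ∑ j ∈ Finset.univ.erase i, if j ∈ U then y r j - ξ r j else 0 := by
      rw [← Finset.sum_filter]
      refine Finset.sum_congr ?_ fun _ _ => rfl
      ext j
      simp [and_comm]
    have e2 : ∑ j ∈ D, (y r j - ξ r j) = ∑ j, if j ∈ D then y r j - ξ r j else 0 := by
      rw [← Finset.sum_filter]
      simp
    rw [e1, e2, ← Finset.add_sum_erase _ _ (Finset.mem_univ i)]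
    have hiU : i ∈ U := by simp [hU, Relation.ReflTransGen.refl]
    refine add_le_add ?_ (Finset.sum_le_sum fun j hj => ?_)
    · rcases lt_or_ge 0 (y r i - ξ r i) with h | h
      · have : i ∈ D := hPD i (by simpa [hP, hiU] using h)
        rw [if_pos this, max_eq_left h.le]
      · rw [max_eq_right h]
        split_ifs with hiD
        · by_contra hlt
          exact (hneg i hiD (not_le.1 hlt)).2 rfl
        · exact le_rfl
    · by_cases hjU : j ∈ U
      · rw [if_pos hjU]
        rcases lt_or_ge 0 (y r j - ξ r j) with h | h
        · rw [if_pos (hPD j (by simpa [hP, hjU] using h))]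
        · split_ifs
          · exact le_rfl
          · exact h
      · rw [if_neg hjU]
        split_ifs with hjD
        · by_contra hlt
          exact hjU (hneg j hjD (not_le.1 hlt)).1
        · exact le_rfl
  set h : Fin N → ℝ := fun j => ∑ r, (y r j - ξ r j) with hh
  have hpos : ∑ r, max (y r i - ξ r i) 0 ≤ ∑ j ∈ Finset.univ.erase i, max (- h j) 0 := by
    have h1 : ∑ r, max (y r i - ξ r i) 0 + ∑ j ∈ U.erase i, h j ≤ 0 := by
      rw [hh, Finset.sum_comm, ← Finset.sum_add_distrib]
      exact Finset.sum_nonpos fun r _ => key r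
    have h2 : ∑ j ∈ U.erase i, - h j ≤ ∑ j ∈ U.erase i, max (- h j) 0 :=
      Finset.sum_le_sum fun j _ => le_max_left _ _
    have h3 : ∑ j ∈ U.erase i, max (- h j) 0 ≤ ∑ j ∈ Finset.univ.erase i, max (- h j) 0 :=
      Finset.sum_le_sum_of_subset_of_nonneg (Finset.erase_subset_erase _ (Finset.subset_univ _))
        fun j _ _ => le_max_right _ _
    rw [Finset.sum_neg_distrib] at h2
    linarith
  -- The imbalances cancel in total. With `|t| = 2 max(t, 0) - t` this upgrades the bound on
  -- positive parts to one on absolute values without losing a factor 2.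
  have htot : h i + ∑ j ∈ Finset.univ.erase i, h j = 0 := by
    rw [Finset.add_sum_erase _ _ (Finset.mem_univ i), hh, Finset.sum_comm]
    refine Finset.sum_eq_zero fun r _ => ?_
    rw [Finset.sum_sub_distrib, (hy r).2, (hξ r).2, sub_self]
  have habs : ∀ t : ℝ, |t| = 2 * max t 0 - t := by
    intro t
    rcases le_total 0 t with ht | ht
    · rw [abs_of_nonneg ht, max_eq_left ht]; ring
    · rw [abs_of_nonpos ht, max_eq_right ht]; ring
  have e1 : ∑ r, |y r i - ξ r i| = 2 * ∑ r, max (y r i - ξ r i) 0 - h i := by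
    simp only [habs, Finset.sum_sub_distrib, ← Finset.mul_sum, hh]
  have e2 : ∑ j ∈ Finset.univ.erase i, |h j| =
      2 * ∑ j ∈ Finset.univ.erase i, max (- h j) 0 + ∑ j ∈ Finset.univ.erase i, h j := by
    rw [Finset.mul_sum, ← Finset.sum_add_distrib]
    refine Finset.sum_congr rfl fun j _ => ?_
    rw [← abs_neg, habs]
    ring
  rw [e1]
  change _ ≤ ∑ j ∈ Finset.univ.erase i, |h j|
  rw [e2]
  linarith

theorem exists_decomposition_sum_abs_le {G : Fin R → Finset (Fin N) → ℝ}
    (hG : ∀ r, IsSubmodular (G r)) (h0 : ∀ r, G r ∅ = 0) {s : Fin N → ℝ}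
    (hs : (decompositions G s).Nonempty) {y : Fin R → Fin N → ℝ}
    (hy : ∀ r, y r ∈ basePolytope (G r)) :
    ∃ ξ ∈ decompositions G s, ∀ i,
      ∑ r, |y r i - ξ r i| ≤ ∑ j ∈ Finset.univ.erase i, |∑ r, y r j - s j| := by
  obtain ⟨ξ, hξ, hmin⟩ := (isCompact_decompositions G s).exists_isMinOn hs
    (f := fun ξ => ∑ r, ∑ i, |y r i - ξ r i|) (by fun_prop)
  refine ⟨ξ, hξ, fun i => ?_⟩
  have := sum_abs_le_of_acyclic hG h0 hy hξ.1 (not_transGen_self hξ (fun ζ hζ => hmin hζ) i)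
  simpa only [Finset.sum_sub_distrib, ← hξ.2, Finset.sum_apply] using this

/-! ### First-order conditions of the dual problem -/

theorem nonneg_of_forall_quadratic {L Q : ℝ} (h : ∀ t : ℝ, 0 < t → t ≤ 1 → 0 ≤ t * L + t ^ 2 * Q) :
    0 ≤ L := by
  by_contra hL
  push Not at hL
  have hQ : 0 < |Q| + 1 + |L| := by positivity
  have hL' : 0 < |L| := abs_pos.2 hL.ne
  -- This step size is at most 1 and satisfies `t |Q| < |L|`, so the quadratic term cannot offset a
  -- negative `L`.
  have ht : 0 < |L| / (|Q| + 1 + |L|) := by positivity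
  have h1 := h _ ht ((div_le_one hQ).2 (by linarith [abs_nonneg Q]))
  set t := |L| / (|Q| + 1 + |L|)
  have ht' : t * (|Q| + 1 + |L|) = |L| := div_mul_cancel₀ _ hQ.ne'
  have h2 : 0 ≤ L + t * Q := by
    have : t * (L + t * Q) = t * L + t ^ 2 * Q := by ring
    rw [← this] at h1
    exact nonneg_of_mul_nonneg_right h1 ht
  have h3 : t * Q ≤ t * |Q| := mul_le_mul_of_nonneg_left (le_abs_self Q) ht.le
  have h4 : 0 < t * (1 + |L|) := by positivity
  rw [abs_of_neg hL] at *
  nlinarith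

theorem prodCone_add_smul {F : Fin R → Finset (Fin N) → ℝ} (hsub : ∀ r, IsSubmodular (F r))
    (h0 : ∀ r, F r ∅ = 0) {p q : Pt N R} (hp : p ∈ prodCone F) (hq : q ∈ prodCone F) {s t : ℝ}
    (hs : 0 ≤ s) (ht : 0 ≤ t) : s • p + t • q ∈ prodCone F := fun r =>
  coneOf_add_smul (hsub r) (h0 r) (hp r) (hq r) hs ht

/-- The primal point associated with a dual point. -/
noncomputable def primalOf (W a : Fin N → ℝ) (p : Pt N R) (i : Fin N) : ℝ :=
  a i - (W i)⁻¹ * (∑ r, p.1 r i) / 2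

/-- First-order optimality condition of the dual problem. -/
theorem dual_first_order {F : Fin R → Finset (Fin N) → ℝ} (hsub : ∀ r, IsSubmodular (F r))
    (h0 : ∀ r, F r ∅ = 0) {W a : Fin N → ℝ} (hW : ∀ i, 0 < W i) {p : Pt N R}
    (hp : p ∈ dualSolutions F W a) {q : Pt N R} (hq : q ∈ prodCone F) :
    0 ≤ ∑ r, (p.2 r * (q.2 r - p.2 r) -
      2 * ∑ i, primalOf W a p i * (q.1 r i - p.1 r i)) := by
  have key : ∀ t : ℝ, dualObj W a ((1 - t) • p + t • q) = dualObj W a p +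
      t * (2 * ∑ r, (p.2 r * (q.2 r - p.2 r) -
        2 * ∑ i, primalOf W a p i * (q.1 r i - p.1 r i))) +
      t ^ 2 * (∑ i, (W i)⁻¹ * (∑ r, (q.1 r i - p.1 r i)) ^ 2 +
        ∑ r, (q.2 r - p.2 r) ^ 2) := by
    intro t
    have e1 : ∑ r, ∑ i, primalOf W a p i * (q.1 r i - p.1 r i) =
        ∑ i, primalOf W a p i * (∑ r, (q.1 r i - p.1 r i)) := by
      rw [Finset.sum_comm]
      simp only [Finset.mul_sum]
    have e2 : wnormSq (invW W) (∑ r, ((1 - t) • p + t • q).1 r - (2 : ℝ) • (W * a)) =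
        wnormSq (invW W) (∑ r, p.1 r - (2 : ℝ) • (W * a)) -
          4 * t * (∑ i, primalOf W a p i * (∑ r, (q.1 r i - p.1 r i))) +
          t ^ 2 * ∑ i, (W i)⁻¹ * (∑ r, (q.1 r i - p.1 r i)) ^ 2 := by
      simp only [wnormSq, Finset.mul_sum, ← Finset.sum_sub_distrib, ← Finset.sum_add_distrib]
      refine Finset.sum_congr rfl fun i _ => ?_
      rw [← Finset.mul_sum]
      have hWi : W i * (W i)⁻¹ = 1 := mul_inv_cancel₀ (hW i).ne'
      simp only [invW, primalOf, Finset.sum_apply, Pi.sub_apply, Pi.smul_apply, Prod.fst_add,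
        Prod.smul_fst, Pi.add_apply, Pi.mul_apply, smul_eq_mul, Finset.sum_add_distrib,
        ← Finset.mul_sum, Finset.sum_sub_distrib]
      linear_combination (-4 * t * a i * (∑ r, q.1 r i - ∑ r, p.1 r i)) * hWi
    have e3 : ∑ r, ((1 - t) • p + t • q).2 r ^ 2 = ∑ r, p.2 r ^ 2 +
        2 * t * (∑ r, p.2 r * (q.2 r - p.2 r)) + t ^ 2 * ∑ r, (q.2 r - p.2 r) ^ 2 := by
      simp only [Finset.mul_sum, ← Finset.sum_add_distrib]
      refine Finset.sum_congr rfl fun r _ => ?_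
      simp only [Prod.snd_add, Prod.smul_snd, Pi.add_apply, Pi.smul_apply, smul_eq_mul]
      ring
    rw [dualObj, e2, e3, dualObj, Finset.sum_sub_distrib, ← Finset.mul_sum, e1]
    ring
  have h := nonneg_of_forall_quadratic fun t ht ht1 => by
    have := hp.2 _ (prodCone_add_smul hsub h0 hp.1 hq (sub_nonneg.2 ht1) ht.le)
    rw [key t, add_assoc] at this
    exact (le_add_iff_nonneg_right _).1 this
  linarith

theorem dual_first_order_component {F : Fin R → Finset (Fin N) → ℝ}
    (hsub : ∀ r, IsSubmodular (F r)) (h0 : ∀ r, F r ∅ = 0) {W a : Fin N → ℝ}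
    (hW : ∀ i, 0 < W i) {p : Pt N R} (hp : p ∈ dualSolutions F W a) (r : Fin R)
    {c : (Fin N → ℝ) × ℝ} (hc : c ∈ coneOf (F r)) :
    0 ≤ p.2 r * (c.2 - p.2 r) - 2 * ∑ i, primalOf W a p i * (c.1 i - p.1 r i) := by
  have hq : ((Function.update p.1 r c.1, Function.update p.2 r c.2) : Pt N R) ∈ prodCone F := by
    intro r'
    rcases eq_or_ne r' r with rfl | hne
    · simpa using hc
    · simpa [hne] using hp.1 r'
  have := dual_first_order hsub h0 hW hp hq
  rw [Finset.sum_eq_single r (by intro b _ hb; simp [hb]) (by simp)] at this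
  simpa using this

/-- The cone contains the whole ray through the optimal component; testing optimality at its double
and at 0 gives opposite inequalities. -/
theorem dual_complementarity {F : Fin R → Finset (Fin N) → ℝ}
    (hsub : ∀ r, IsSubmodular (F r)) (h0 : ∀ r, F r ∅ = 0) {W a : Fin N → ℝ}
    (hW : ∀ i, 0 < W i) {p : Pt N R} (hp : p ∈ dualSolutions F W a) (r : Fin R) :
    p.2 r ^ 2 = 2 * ∑ i, primalOf W a p i * p.1 r i := by
  have h1 := dual_first_order_component hsub h0 hW hp r
    (coneOf_add_smul (hsub r) (h0 r) (hp.1 r) (hp.1 r) zero_le_one zero_le_one)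
  have h2 := dual_first_order_component hsub h0 hW hp r
    (coneOf_add_smul (hsub r) (h0 r) (hp.1 r) (hp.1 r) le_rfl le_rfl)
  simp at h1 h2
  nlinarith

/-- Testing optimality at `(w, 1)`, with `w` in the base polytope attaining `f_r(x)`, gives `2
f_r(x) ≤ φ_r`; complementarity gives `φ_r² ≤ 2 φ_r f_r(x)`. Thus `φ` depends only on the primal
point. -/
theorem dual_phi {F : Fin R → Finset (Fin N) → ℝ}
    (hsub : ∀ r, IsSubmodular (F r)) (h0 : ∀ r, F r ∅ = 0) {W a : Fin N → ℝ}
    (hW : ∀ i, 0 < W i) {p : Pt N R} (hp : p ∈ dualSolutions F W a) (r : Fin R) :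
    p.2 r = 2 * max (lovasz (F r) (primalOf W a p)) 0 := by
  have hcomp := dual_complementarity hsub h0 hW hp r
  obtain ⟨hφ, z, hz, hzy⟩ := hp.1 r
  have hzy : p.2 r • z = p.1 r := hzy
  have hφ : 0 ≤ p.2 r := hφ
  have hle : 2 * lovasz (F r) (primalOf W a p) ≤ p.2 r := by
    obtain ⟨w, hw, hwl⟩ := exists_sum_mul_eq_lovasz (hsub r) (h0 r) (primalOf W a p)
    have := dual_first_order_component hsub h0 hW hp r (c := (w, 1))
      ⟨zero_le_one, w, hw, one_smul _ _⟩
    simp only [mul_sub, Finset.sum_sub_distrib] at this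
    have e : ∑ i, primalOf W a p i * w i = lovasz (F r) (primalOf W a p) := by
      rw [← hwl]
      exact Finset.sum_congr rfl fun i _ => mul_comm _ _
    rw [e] at this
    nlinarith
  have hge : p.2 r ^ 2 ≤ 2 * (p.2 r * lovasz (F r) (primalOf W a p)) := by
    rw [hcomp, ← hzy]
    have e : ∑ i, primalOf W a p i * (p.2 r • z) i = p.2 r * ∑ i, z i * primalOf W a p i := by
      rw [Finset.mul_sum]
      exact Finset.sum_congr rfl fun i _ => by simp; ring
    rw [e]
    have := mul_le_mul_of_nonneg_left (sum_mul_le_lovasz hz (primalOf W a p)) hφ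
    linarith
  rcases hφ.eq_or_lt with h | h
  · rw [max_eq_right (by linarith)]
    linarith
  · have : p.2 r ≤ 2 * lovasz (F r) (primalOf W a p) := by nlinarith
    rw [max_eq_left (by linarith)]
    linarith

/-! ### Identification of the primal point -/

/-- Objective of the primal problem with `f_r` replaced by its positive part. -/
noncomputable def posObj (F : Fin R → Finset (Fin N) → ℝ) (W a x : Fin N → ℝ) : ℝ :=
  wnormSq W (x - a) + ∑ r, max (lovasz (F r) x) 0 ^ 2

/-- Since `φ_r = 2 max(f_r(u), 0)`, the vector `y_r` is a subgradient of `max(f_r, 0)²` at `u`, and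
`∑ y_r` cancels the gradient of the quadratic term. What remains is the strong convexity of that
term. -/
theorem posObj_growth {F : Fin R → Finset (Fin N) → ℝ}
    (hsub : ∀ r, IsSubmodular (F r)) (h0 : ∀ r, F r ∅ = 0) {W a : Fin N → ℝ}
    (hW : ∀ i, 0 < W i) {p : Pt N R} (hp : p ∈ dualSolutions F W a) (x : Fin N → ℝ) :
    posObj F W a (primalOf W a p) + wnormSq W (x - primalOf W a p) ≤ posObj F W a x := by
  set u := primalOf W a p with hu
  have h1 : ∀ r, max (lovasz (F r) u) 0 ^ 2 + ∑ i, p.1 r i * (x i - u i) ≤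
      max (lovasz (F r) x) 0 ^ 2 := by
    intro r
    have hcomp := dual_complementarity hsub h0 hW hp r
    rw [← hu] at hcomp
    have hphi := dual_phi hsub h0 hW hp r
    rw [← hu] at hphi
    obtain ⟨hφ, z, hz, hzy⟩ := hp.1 r
    have hzy : p.2 r • z = p.1 r := hzy
    have hφ : 0 ≤ p.2 r := hφ
    have e1 : ∑ i, p.1 r i * (x i - u i) = p.2 r * ∑ i, z i * x i - p.2 r ^ 2 / 2 := by
      rw [hcomp, ← hzy, mul_div_cancel_left₀ _ two_ne_zero, Finset.mul_sum,
        ← Finset.sum_sub_distrib]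
      exact Finset.sum_congr rfl fun i _ => by simp; ring
    have h2 := mul_le_mul_of_nonneg_left
      ((sum_mul_le_lovasz hz x).trans (le_max_left _ 0)) hφ
    rw [e1]
    have e2 : max (lovasz (F r) u) 0 = p.2 r / 2 := by linarith
    rw [e2]
    nlinarith [sq_nonneg (max (lovasz (F r) x) 0 - p.2 r / 2)]
  have h2 : wnormSq W (x - a) = wnormSq W (u - a) + wnormSq W (x - u) -
      ∑ r, ∑ i, p.1 r i * (x i - u i) := by
    rw [Finset.sum_comm]
    simp only [wnormSq, ← Finset.sum_add_distrib, ← Finset.sum_sub_distrib]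
    refine Finset.sum_congr rfl fun i _ => ?_
    have hWi : W i * (W i)⁻¹ = 1 := mul_inv_cancel₀ (hW i).ne'
    rw [← Finset.sum_mul]
    have : ∑ r, p.1 r i = 2 * W i * (a i - u i) := by
      rw [hu, primalOf]
      linear_combination (-∑ r, p.1 r i) * hWi
    rw [this]
    simp only [Pi.sub_apply]
    ring
  have h3 := Finset.sum_le_sum fun r (_ : r ∈ Finset.univ) => h1 r
  rw [Finset.sum_add_distrib] at h3
  simp only [posObj]
  linarith

theorem lovasz_convex {F : Finset (Fin N) → ℝ} (hF : IsSubmodular F) (h0 : F ∅ = 0)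
    (x y : Fin N → ℝ) {t : ℝ} (ht : 0 ≤ t) (ht1 : t ≤ 1) :
    lovasz F (x + t • (y - x)) ≤ (1 - t) * lovasz F x + t * lovasz F y := by
  obtain ⟨z, hz, hzl⟩ := exists_sum_mul_eq_lovasz hF h0 (x + t • (y - x))
  have h1 := mul_le_mul_of_nonneg_left (sum_mul_le_lovasz hz x) (sub_nonneg.2 ht1)
  have h2 := mul_le_mul_of_nonneg_left (sum_mul_le_lovasz hz y) ht
  rw [← hzl]
  refine le_trans (le_of_eq ?_) (add_le_add h1 h2)
  rw [Finset.mul_sum, Finset.mul_sum, ← Finset.sum_add_distrib]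
  exact Finset.sum_congr rfl fun i _ => by simp; ring

/-- A point where the Lovász extension is nonnegative has it bounded below linearly along every
segment, so that squaring it costs at most a second-order term over its positive part. -/
theorem exists_lovasz_sq_le {F : Finset (Fin N) → ℝ} (hF : IsSubmodular F) (h0 : F ∅ = 0)
    {x : Fin N → ℝ} (hx : 0 ≤ lovasz F x) (y : Fin N → ℝ) :
    ∃ C : ℝ, ∀ t : ℝ, 0 ≤ t → t ≤ 1 → lovasz F (x + t • (y - x)) ^ 2 ≤
      (1 - t) * max (lovasz F x) 0 ^ 2 + t * max (lovasz F y) 0 ^ 2 + t ^ 2 * C := by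
  obtain ⟨z, hz, hzl⟩ := exists_sum_mul_eq_lovasz hF h0 x
  refine ⟨(∑ i, z i * (y i - x i)) ^ 2, fun t ht ht1 => ?_⟩
  have hconv := lovasz_convex hF h0 x y ht ht1
  set c := ∑ i, z i * (y i - x i) with hc
  have hlow : t * c ≤ lovasz F (x + t • (y - x)) := by
    have h1 := sum_mul_le_lovasz hz (x + t • (y - x))
    have e : ∑ i, z i * (x + t • (y - x)) i = lovasz F x + t * c := by
      rw [← hzl, hc, Finset.mul_sum, ← Finset.sum_add_distrib]
      exact Finset.sum_congr rfl fun i _ => by simp; ring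
    linarith
  set m := lovasz F (x + t • (y - x))
  set A := max (lovasz F x) 0
  set B := max (lovasz F y) 0
  have hA : 0 ≤ A := le_max_right _ _
  have hB : 0 ≤ B := le_max_right _ _
  have h1 : m ≤ (1 - t) * A + t * B := by
    have a := mul_le_mul_of_nonneg_left (le_max_left (lovasz F x) 0) (sub_nonneg.2 ht1)
    have b := mul_le_mul_of_nonneg_left (le_max_left (lovasz F y) 0) ht
    linarith
  have hs : 0 ≤ 1 - t := sub_nonneg.2 ht1
  rcases le_total 0 m with hm | hm
  · have h2 : m ^ 2 ≤ ((1 - t) * A + t * B) ^ 2 := pow_le_pow_left₀ hm h1 2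
    have h3 : ((1 - t) * A + t * B) ^ 2 ≤ (1 - t) * A ^ 2 + t * B ^ 2 := by
      nlinarith [mul_nonneg (mul_nonneg hs ht) (sq_nonneg (A - B))]
    nlinarith [mul_nonneg (sq_nonneg t) (sq_nonneg c)]
  · have h2 : m ^ 2 ≤ (t * c) ^ 2 := by nlinarith
    have h3 : 0 ≤ (1 - t) * A ^ 2 + t * B ^ 2 := by positivity
    nlinarith

theorem primalOf_eq {F : Fin R → Finset (Fin N) → ℝ}
    (hsub : ∀ r, IsSubmodular (F r)) (h0 : ∀ r, F r ∅ = 0) {W a : Fin N → ℝ}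
    (hW : ∀ i, 0 < W i) {xs : Fin N → ℝ} (hxs : IsPrimalSolution F W a xs)
    (hf : ∀ r, 0 ≤ lovasz (F r) xs) {p : Pt N R} (hp : p ∈ dualSolutions F W a) :
    primalOf W a p = xs := by
  set u := primalOf W a p with hu
  choose C hC using fun r => exists_lovasz_sq_le (hsub r) (h0 r) (hf r) u
  have hxpos : primalObj F W a xs = posObj F W a xs := by
    simp only [primalObj, posObj, max_eq_left (hf _)]
  have hle : posObj F W a xs ≤ posObj F W a u := by
    rw [← sub_nonneg]
    -- Replacing `f_r²` by the square of its positive part along the segment costs only `t² C r`,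
    -- which does not affect the first-order comparison.
    refine nonneg_of_forall_quadratic (Q := ∑ r, C r) fun t ht ht1 => ?_
    have h1 := hxs (xs + t • (u - xs))
    rw [hxpos] at h1
    have h2 := Finset.sum_le_sum fun r (_ : r ∈ Finset.univ) => hC r t ht.le ht1
    rw [Finset.sum_add_distrib, Finset.sum_add_distrib, ← Finset.mul_sum, ← Finset.mul_sum,
      ← Finset.mul_sum] at h2
    have h3 : wnormSq W (xs + t • (u - xs) - a) ≤
        (1 - t) * wnormSq W (xs - a) + t * wnormSq W (u - a) := by
      simp only [wnormSq, Finset.mul_sum, ← Finset.sum_add_distrib]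
      refine Finset.sum_le_sum fun i _ => ?_
      simp only [Pi.sub_apply, Pi.add_apply, Pi.smul_apply, smul_eq_mul]
      have : 0 ≤ W i * ((1 - t) * t * (u i - xs i) ^ 2) :=
        mul_nonneg (hW i).le (mul_nonneg (mul_nonneg (sub_nonneg.2 ht1) ht.le) (sq_nonneg _))
      linarith
    simp only [primalObj, posObj] at h1 ⊢
    linarith
  have hg := posObj_growth hsub h0 hW hp xs
  rw [← hu] at hg
  have hz : wnormSq W (xs - u) = 0 := by
    refine le_antisymm (by linarith) ?_
    exact Finset.sum_nonneg fun i _ => mul_nonneg (hW i).le (sq_nonneg _)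
  rw [wnormSq, Finset.sum_eq_zero_iff_of_nonneg fun i _ =>
    mul_nonneg (hW i).le (sq_nonneg _)] at hz
  ext i
  have := hz i (Finset.mem_univ i)
  simp only [Pi.sub_apply, mul_eq_zero, (hW i).ne', false_or, pow_eq_zero_iff two_ne_zero] at this
  linarith

theorem sum_eq_of_mem_dualSolutions {F : Fin R → Finset (Fin N) → ℝ}
    (hsub : ∀ r, IsSubmodular (F r)) (h0 : ∀ r, F r ∅ = 0) {W a : Fin N → ℝ}
    (hW : ∀ i, 0 < W i) {xs : Fin N → ℝ} (hxs : IsPrimalSolution F W a xs)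
    (hf : ∀ r, 0 ≤ lovasz (F r) xs) {p : Pt N R} (hp : p ∈ dualSolutions F W a) :
    ∑ r, p.1 r = (2 : ℝ) • (W * (a - xs)) := by
  have h := primalOf_eq hsub h0 hW hxs hf hp
  ext i
  have hi := congrFun h i
  have hWi : W i * (W i)⁻¹ = 1 := mul_inv_cancel₀ (hW i).ne'
  simp only [primalOf] at hi
  simp only [Finset.sum_apply, Pi.smul_apply, Pi.mul_apply, Pi.sub_apply, smul_eq_mul, ← hi]
  linear_combination (-∑ r, p.1 r i) * hWi

/-! ### The weights `Ψ` and the identity `Ξ = 𝒞 ∩ 𝒵` -/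

theorem Psi_pos {F : Fin R → Finset (Fin N) → ℝ} (hinc : ∀ i, ∃ r, i ∈ support (F r))
    (i : Fin N) : 0 < Psi F i := by
  obtain ⟨r, hr⟩ := hinc i
  rw [Psi, Nat.cast_pos, Finset.card_pos]
  exact ⟨r, by simpa using hr⟩

theorem PsiInvW_pos {F : Fin R → Finset (Fin N) → ℝ} (hinc : ∀ i, ∃ r, i ∈ support (F r))
    {W : Fin N → ℝ} (hW : ∀ i, 0 < W i) (i : Fin N) : 0 < PsiInvW F W i :=
  mul_pos (Psi_pos hinc i) (inv_pos.2 (hW i))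

/-- Cauchy–Schwarz for vectors vanishing off the support. -/
theorem sq_sum_le_Psi_mul (F : Fin R → Finset (Fin N) → ℝ) (i : Fin N) {u : Fin R → ℝ}
    (hu : ∀ r, i ∉ support (F r) → u r = 0) : (∑ r, u r) ^ 2 ≤ Psi F i * ∑ r, u r ^ 2 := by
  classical
  have h1 : ∑ r ∈ Finset.univ.filter (fun r => i ∈ support (F r)), u r = ∑ r, u r := by
    refine Finset.sum_filter_of_ne fun r _ h => ?_
    by_contra hr
    exact h (hu r hr)
  have h2 : ∑ r ∈ Finset.univ.filter (fun r => i ∈ support (F r)), u r ^ 2 = ∑ r, u r ^ 2 := by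
    refine Finset.sum_filter_of_ne fun r _ h => ?_
    by_contra hr
    exact h (by simp [hu r hr])
  rw [← h1, ← h2, Psi]
  have := sq_sum_le_card_mul_sum_sq (s := Finset.univ.filter fun r => i ∈ support (F r)) (f := u)
  convert this

theorem sum_ite_support (F : Fin R → Finset (Fin N) → ℝ) [∀ r i, Decidable (i ∈ support (F r))]
    (i : Fin N) (c : ℝ) : ∑ r, (if i ∈ support (F r) then c else 0) = Psi F i * c := by
  rw [← Finset.sum_filter, Finset.sum_const, nsmul_eq_mul, Psi]
  congr!

/-- For fixed `(y, φ)`, minimizing over `Λ` gives the dual objective: Cauchy–Schwarz is the lower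
bound, and equal sharing of the residual among incident functions attains it. -/
theorem mem_dualSolutions_of_isApproxSolution {F : Fin R → Finset (Fin N) → ℝ}
    (h0 : ∀ r, F r ∅ = 0) (hinc : ∀ i, ∃ r, i ∈ support (F r)) {W a : Fin N → ℝ}
    (hW : ∀ i, 0 < W i) {p : Pt N R} {L : Fin R → Fin N → ℝ}
    (h : IsApproxSolution F W a p L) : p ∈ dualSolutions F W a := by
  classical
  refine ⟨h.1, fun q hq => ?_⟩
  have hsupp : ∀ q ∈ prodCone F, ∀ r i, i ∉ support (F r) → q.1 r i = 0 := fun q hq r i hi =>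
    eq_zero_of_mem_coneOf (h0 r) (hq r) hi
  have hlow : dualObj W a p ≤ approxObj F W p L := by
    rw [dualObj, approxObj, Finset.sum_add_distrib]
    refine add_le_add ?_ le_rfl
    simp only [wnormSq]
    rw [Finset.sum_comm]
    refine Finset.sum_le_sum fun i _ => ?_
    have h1 := sq_sum_le_Psi_mul F i (u := fun r => p.1 r i - L r i) fun r hr => by
      rw [hsupp p h.1 r i hr, h.2.1.2 r i hr, sub_zero]
    have e : (∑ r, p.1 r - (2 : ℝ) • (W * a)) i = ∑ r, (p.1 r i - L r i) := by
      rw [← h.2.1.1]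
      simp
    rw [e, ← Finset.mul_sum]
    simp only [invW, PsiInvW, Pi.sub_apply]
    have := mul_le_mul_of_nonneg_left h1 (inv_pos.2 (hW i)).le
    linarith
  set δ : Fin N → ℝ := fun i => (∑ r, q.1 r i) - 2 * (W i * a i) with hδ
  set M : Fin R → Fin N → ℝ := fun r i =>
    q.1 r i - if i ∈ support (F r) then (Psi F i)⁻¹ * δ i else 0 with hM
  have hMmem : M ∈ lamSet F W a := by
    refine ⟨?_, fun r i hi => ?_⟩
    · ext i
      simp only [Finset.sum_apply, hM, Finset.sum_sub_distrib, sum_ite_support]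
      rw [mul_inv_cancel_left₀ (Psi_pos hinc i).ne', hδ]
      simp
    · simp [hM, hi, hsupp q hq r i hi]
  have hup : approxObj F W q M = dualObj W a q := by
    rw [dualObj, approxObj, Finset.sum_add_distrib]
    congr 1
    simp only [wnormSq]
    rw [Finset.sum_comm]
    refine Finset.sum_congr rfl fun i _ => ?_
    have e : ∀ r, PsiInvW F W i * (q.1 r - M r) i ^ 2 =
        if i ∈ support (F r) then PsiInvW F W i * ((Psi F i)⁻¹ * δ i) ^ 2 else 0 := by
      intro r
      simp only [hM, Pi.sub_apply, sub_sub_cancel]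
      split_ifs <;> simp
    have e2 : (∑ r, q.1 r - (2 : ℝ) • (W * a)) i = δ i := by simp [hδ]
    rw [Finset.sum_congr rfl fun r _ => e r, sum_ite_support, e2]
    have := (Psi_pos hinc i).ne'
    simp only [PsiInvW, invW]
    field_simp
  exact hlow.trans ((h.2.2 q hq M hMmem).trans hup.le)

theorem mem_dualSolutions_iff {F : Fin R → Finset (Fin N) → ℝ}
    (hsub : ∀ r, IsSubmodular (F r)) (h0 : ∀ r, F r ∅ = 0) {W a : Fin N → ℝ}
    (hW : ∀ i, 0 < W i) {xs : Fin N → ℝ} (hxs : IsPrimalSolution F W a xs)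
    (hf : ∀ r, 0 ≤ lovasz (F r) xs) {ξ : Pt N R} (hξ : ξ ∈ dualSolutions F W a) {p : Pt N R} :
    p ∈ dualSolutions F W a ↔ p ∈ prodCone F ∧ p ∈ affineZ F W a xs ξ.2 := by
  constructor
  · intro hp
    refine ⟨hp.1, sum_eq_of_mem_dualSolutions hsub h0 hW hxs hf hp, fun r => ?_, fun r i hi => ?_⟩
    · rw [dual_phi hsub h0 hW hp, dual_phi hsub h0 hW hξ, primalOf_eq hsub h0 hW hxs hf hp,
        primalOf_eq hsub h0 hW hxs hf hξ]
    · exact eq_zero_of_mem_coneOf (h0 r) (hp.1 r) hi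
  · rintro ⟨hp, hs, hφ, -⟩
    refine ⟨hp, fun q hq => ?_⟩
    have : dualObj W a p = dualObj W a ξ := by
      simp only [dualObj, hs, hφ, sum_eq_of_mem_dualSolutions hsub h0 hW hxs hf hξ]
    rw [this]
    exact hξ.2 q hq

/-! ### Elementary inequalities, `ρ`, and weighted distances -/

/-- The difference of the two sides is the sum of `|e r * e t| + e r * e t` over ordered pairs `r ≠
t`. Knowing the net change `∑ e r` as well as the `ℓ¹` norm thus sharpens the bound on squares. -/
theorem two_mul_sum_sq_le {ι : Type*} (s : Finset ι) (e : ι → ℝ) :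
    2 * ∑ r ∈ s, e r ^ 2 ≤ (∑ r ∈ s, |e r|) ^ 2 + (∑ r ∈ s, e r) ^ 2 := by
  induction s using Finset.cons_induction with
  | empty => simp
  | cons a s ha ih =>
    simp only [Finset.sum_cons]
    have h1 : |e a| ^ 2 = e a ^ 2 := sq_abs _
    have h2 : |∑ r ∈ s, e r| ≤ ∑ r ∈ s, |e r| := Finset.abs_sum_le_sum_abs _ _
    have h3 : -(|e a| * |∑ r ∈ s, e r|) ≤ e a * ∑ r ∈ s, e r := by
      rw [← abs_mul]
      exact neg_abs_le _
    have h4 := mul_le_mul_of_nonneg_left h2 (abs_nonneg (e a))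
    nlinarith

theorem bddAbove_rho (F : Fin R → Finset (Fin N) → ℝ) :
    BddAbove {t | ∃ y : Fin R → Fin N → ℝ, (∀ r, y r ∈ basePolytope (F r)) ∧
      t = Real.sqrt (∑ r, (∑ i, |y r i|) ^ 2)} := by
  have hK : IsCompact (Set.univ.pi fun r => basePolytope (F r)) :=
    isCompact_univ_pi fun r => isCompact_basePolytope (F r)
  have hc : Continuous fun y : Fin R → Fin N → ℝ => Real.sqrt (∑ r, (∑ i, |y r i|) ^ 2) := by
    fun_prop
  refine (hK.image hc).bddAbove.mono ?_
  rintro t ⟨y, hy, rfl⟩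
  exact ⟨y, fun r _ => hy r, rfl⟩

theorem sum_sq_le_rho_sq {F : Fin R → Finset (Fin N) → ℝ} {z : Fin R → Fin N → ℝ}
    (hz : ∀ r, z r ∈ basePolytope (F r)) : ∑ r, (∑ i, |z r i|) ^ 2 ≤ rho F ^ 2 := by
  have h : Real.sqrt (∑ r, (∑ i, |z r i|) ^ 2) ≤ rho F :=
    le_csSup (bddAbove_rho F) ⟨z, hz, rfl⟩
  exact (Real.sqrt_le_left ((Real.sqrt_nonneg _).trans h)).1 h

theorem one_le_mu {F : Fin R → Finset (Fin N) → ℝ} {W1 W2 : Fin N → ℝ} (h : ∀ i, 0 ≤ W1 i) :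
    1 ≤ mu F W1 W2 := by
  have : 0 ≤ 9 / 4 * rho F ^ 2 * ∑ i, W1 i :=
    mul_nonneg (by positivity) (Finset.sum_nonneg fun i _ => h i)
  exact le_max_of_le_right (by linarith)

/-- Squared weighted distance of two pairs. -/
noncomputable def dsq (w : Fin N → ℝ) (p q : Pt N R) : ℝ :=
  ∑ r, wnormSq w (p.1 r - q.1 r) + ∑ r, (p.2 r - q.2 r) ^ 2

/-- Weighted inner product of two pairs. -/
noncomputable def dinner (w : Fin N → ℝ) (p q : Pt N R) : ℝ :=
  ∑ r, ∑ i, w i * (p.1 r i * q.1 r i) + ∑ r, p.2 r * q.2 r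

theorem dsq_nonneg {w : Fin N → ℝ} (hw : ∀ i, 0 ≤ w i) (p q : Pt N R) : 0 ≤ dsq w p q :=
  add_nonneg (Finset.sum_nonneg fun _ _ => Finset.sum_nonneg fun i _ =>
    mul_nonneg (hw i) (sq_nonneg _)) (Finset.sum_nonneg fun _ _ => sq_nonneg _)

theorem dsq_eq_add (w : Fin N → ℝ) (p z q : Pt N R) :
    dsq w p q = dsq w p z + dsq w z q + 2 * dinner w (p - z) (z - q) := by
  simp only [dsq, dinner, wnormSq, mul_add, Finset.mul_sum]
  have e1 : ∑ r, ∑ i, w i * (p.1 r - q.1 r) i ^ 2 = ∑ r, ∑ i, w i * (p.1 r - z.1 r) i ^ 2 +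
      ∑ r, ∑ i, w i * (z.1 r - q.1 r) i ^ 2 +
      ∑ r, ∑ i, 2 * (w i * ((p - z).1 r i * (z - q).1 r i)) := by
    simp only [← Finset.sum_add_distrib]
    refine Finset.sum_congr rfl fun r _ => Finset.sum_congr rfl fun i _ => ?_
    simp
    ring
  have e2 : ∑ r, (p.2 r - q.2 r) ^ 2 = ∑ r, (p.2 r - z.2 r) ^ 2 + ∑ r, (z.2 r - q.2 r) ^ 2 +
      ∑ r, 2 * ((p - z).2 r * (z - q).2 r) := by
    simp only [← Finset.sum_add_distrib]
    refine Finset.sum_congr rfl fun r _ => ?_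
    simp
    ring
  rw [e1, e2]
  ring

theorem dsq_comm (w : Fin N → ℝ) (p q : Pt N R) : dsq w p q = dsq w q p := by
  simp only [dsq, wnormSq, Pi.sub_apply]
  congr 1
  · exact Finset.sum_congr rfl fun r _ => Finset.sum_congr rfl fun i _ => by ring
  · exact Finset.sum_congr rfl fun r _ => by ring

theorem add_sq_le_young {m : ℝ} (hm : 0 < m) (x y : ℝ) :
    (x + y) ^ 2 ≤ (1 + m) * x ^ 2 + (1 + m⁻¹) * y ^ 2 := by
  have h : (1 + m) * x ^ 2 + (1 + m⁻¹) * y ^ 2 - (x + y) ^ 2 = m⁻¹ * (m * x - y) ^ 2 := by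
    field_simp
    ring
  have : 0 ≤ m⁻¹ * (m * x - y) ^ 2 := by positivity
  linarith

theorem dsq_young {w : Fin N → ℝ} (hw : ∀ i, 0 ≤ w i) {m : ℝ} (hm : 0 < m) (p z q : Pt N R) :
    dsq w p q ≤ (1 + m) * dsq w p z + (1 + m⁻¹) * dsq w z q := by
  have h1 : ∑ r, wnormSq w (p.1 r - q.1 r) ≤ (1 + m) * ∑ r, wnormSq w (p.1 r - z.1 r) +
      (1 + m⁻¹) * ∑ r, wnormSq w (z.1 r - q.1 r) := by
    simp only [wnormSq, Finset.mul_sum, ← Finset.sum_add_distrib]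
    refine Finset.sum_le_sum fun r _ => Finset.sum_le_sum fun i _ => ?_
    have := mul_le_mul_of_nonneg_left
      (add_sq_le_young hm (p.1 r i - z.1 r i) (z.1 r i - q.1 r i)) (hw i)
    rw [sub_add_sub_cancel] at this
    simp only [Pi.sub_apply]
    linarith
  have h2 : ∑ r, (p.2 r - q.2 r) ^ 2 ≤ (1 + m) * ∑ r, (p.2 r - z.2 r) ^ 2 +
      (1 + m⁻¹) * ∑ r, (z.2 r - q.2 r) ^ 2 := by
    simp only [Finset.mul_sum, ← Finset.sum_add_distrib]
    refine Finset.sum_le_sum fun r _ => ?_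
    have := add_sq_le_young hm (p.2 r - z.2 r) (z.2 r - q.2 r)
    rwa [sub_add_sub_cancel] at this
  simp only [dsq]
  linarith

/-! ### Distance from `𝒞` to `Ξ` -/

/-- Every feasible dual point has a dual solution near it, coordinate by coordinate. -/
theorem exists_dualSolution_sum_sq_le {F : Fin R → Finset (Fin N) → ℝ}
    (hsub : ∀ r, IsSubmodular (F r)) (h0 : ∀ r, F r ∅ = 0) {q ξ : Pt N R}
    (hq : q ∈ prodCone F) (hξ : ξ ∈ prodCone F) :
    ∃ y : Fin R → Fin N → ℝ, (y, ξ.2) ∈ prodCone F ∧ ∑ r, y r = ∑ r, ξ.1 r ∧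
      ∀ i, ∑ r, (q.1 r i - y r i) ^ 2 ≤ (∑ j, |∑ r, q.1 r j - ∑ r, ξ.1 r j|) ^ 2 +
        rho F ^ 2 * ∑ r, (q.2 r - ξ.2 r) ^ 2 := by
  have hξ' := fun r => (mem_coneOf_iff (hsub r) (h0 r)).1 (hξ r)
  choose z hz hzq using fun r => (hq r).2
  have hzq : ∀ r i, q.1 r i = q.2 r * z r i := fun r i => (congrFun (hzq r) i).symm
  -- Each component is first rescaled to the target `φ`, so that it lies in the right base polytope;
  -- the decomposition bound then corrects the sum.
  obtain ⟨y, hy, hyb⟩ := exists_decomposition_sum_abs_le (G := fun r => ξ.2 r • F r)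
    (s := ∑ r, ξ.1 r) (fun r => (hsub r).smul (hξ' r).1) (fun r => by simp [h0 r])
    ⟨ξ.1, fun r => (hξ' r).2, rfl⟩ (y := fun r => ξ.2 r • z r)
    (fun r => smul_mem_basePolytope_smul (hz r) (hξ' r).1)
  refine ⟨y, fun r => (mem_coneOf_iff (hsub r) (h0 r)).2 ⟨(hξ' r).1, hy.1 r⟩, hy.2, fun i => ?_⟩
  set c : Fin R → ℝ := fun r => |q.2 r - ξ.2 r| with hc
  set h : Fin N → ℝ := fun j => ∑ r, q.1 r j - ∑ r, ξ.1 r j with hh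
  set G := ∑ r, c r * ∑ j, |z r j| with hG
  have hdiff : ∀ r j, |q.1 r j - ξ.2 r * z r j| = c r * |z r j| := fun r j => by
    rw [hzq, ← sub_mul, abs_mul]
  have h1 : ∀ j, |∑ r, (ξ.2 r • z r) j - (∑ r, ξ.1 r) j| ≤ |h j| + ∑ r, c r * |z r j| := by
    intro j
    have e : ∑ r, (ξ.2 r • z r) j - (∑ r, ξ.1 r) j =
        h j - ∑ r, (q.1 r j - ξ.2 r * z r j) := by
      simp [hh, Finset.sum_sub_distrib]
    rw [e]
    refine (abs_sub _ _).trans (add_le_add le_rfl ?_)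
    refine (Finset.abs_sum_le_sum_abs _ _).trans (le_of_eq ?_)
    exact Finset.sum_congr rfl fun r _ => hdiff r j
  -- Rescaling costs coordinate `i` its own share of `G`, and the correction costs the shares of the
  -- other coordinates, so `G` is paid only once.
  have habs : ∑ r, |q.1 r i - y r i| ≤ G + (∑ j, |h j| - |h i|) := by
    have h2 : ∑ r, |q.1 r i - y r i| ≤ ∑ r, (c r * |z r i| + |(ξ.2 r • z r) i - y r i|) := by
      refine Finset.sum_le_sum fun r _ => ?_
      rw [← hdiff]
      refine le_trans (le_of_eq ?_) (abs_add_le _ _)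
      simp
    rw [Finset.sum_add_distrib] at h2
    have h3 := (hyb i).trans (Finset.sum_le_sum fun j _ => h1 j)
    rw [Finset.sum_add_distrib] at h3
    have e1 := Finset.add_sum_erase Finset.univ (fun j => |h j|) (Finset.mem_univ i)
    have e2 := Finset.add_sum_erase Finset.univ (fun j => ∑ r, c r * |z r j|) (Finset.mem_univ i)
    have e3 : ∑ j, ∑ r, c r * |z r j| = G := by
      rw [Finset.sum_comm, hG]
      simp only [Finset.mul_sum]
    linarith
  have hsum : ∑ r, (q.1 r i - y r i) = h i := by
    have := congrFun hy.2 i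
    simp only [Finset.sum_apply] at this
    rw [Finset.sum_sub_distrib, this]
  have hG2 : G ^ 2 ≤ rho F ^ 2 * ∑ r, (q.2 r - ξ.2 r) ^ 2 := by
    have h2 := Finset.sum_mul_sq_le_sq_mul_sq Finset.univ c fun r => ∑ j, |z r j|
    have h3 : ∑ r, c r ^ 2 = ∑ r, (q.2 r - ξ.2 r) ^ 2 :=
      Finset.sum_congr rfl fun r _ => sq_abs _
    rw [h3] at h2
    have h4 := mul_le_mul_of_nonneg_left (sum_sq_le_rho_sq hz)
      (Finset.sum_nonneg fun r (_ : r ∈ Finset.univ) => sq_nonneg (q.2 r - ξ.2 r))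
    linarith
  have h2 := two_mul_sum_sq_le Finset.univ fun r => q.1 r i - y r i
  simp only [hsum] at h2
  have hGn : 0 ≤ G := Finset.sum_nonneg fun r _ =>
    mul_nonneg (abs_nonneg _) (Finset.sum_nonneg fun j _ => abs_nonneg _)
  have hti : |h i| ≤ ∑ j, |h j| :=
    Finset.single_le_sum (f := fun j => |h j|) (fun j _ => abs_nonneg _) (Finset.mem_univ i)
  have h3 : (∑ r, |q.1 r i - y r i|) ^ 2 ≤ (G + (∑ j, |h j| - |h i|)) ^ 2 :=
    pow_le_pow_left₀ (Finset.sum_nonneg fun _ _ => abs_nonneg _) habs 2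
  have h4 : h i ^ 2 = |h i| ^ 2 := (sq_abs _).symm
  have ht := abs_nonneg (h i)
  set S := ∑ j, |h j|
  -- By `(G + A)² ≤ 2 G² + 2 A²` with `A = S - |h i|`, and `2 A² + |h i|² ≤ 2 S²` because `0 ≤ |h i|
  -- ≤ S`.
  have h5 : (G + (S - |h i|)) ^ 2 + |h i| ^ 2 ≤ 2 * (S ^ 2 + G ^ 2) := by
    nlinarith [sq_nonneg (G - (S - |h i|)), mul_nonneg (sub_nonneg.2 hti) ht]
  linarith

theorem sq_sum_abs_le {W : Fin N → ℝ} (hW : ∀ i, 0 < W i) (h : Fin N → ℝ) :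
    (∑ j, |h j|) ^ 2 ≤ (∑ j, W j) * ∑ j, (W j)⁻¹ * h j ^ 2 := by
  refine Finset.sum_sq_le_sum_mul_sum_of_sq_le_mul _ (fun j _ => (hW j).le)
    (fun j _ => mul_nonneg (inv_pos.2 (hW j)).le (sq_nonneg _)) fun j _ => ?_
  rw [sq_abs, mul_inv_cancel_left₀ (hW j).ne']

theorem exists_dualSolution_dsq_le {F : Fin R → Finset (Fin N) → ℝ}
    (hsub : ∀ r, IsSubmodular (F r)) (h0 : ∀ r, F r ∅ = 0) {W : Fin N → ℝ}
    (hW : ∀ i, 0 < W i) {w : Fin N → ℝ} (hw : ∀ i, 0 ≤ w i) {q ξ : Pt N R}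
    (hq : q ∈ prodCone F) (hξ : ξ ∈ prodCone F) :
    ∃ y : Fin R → Fin N → ℝ, (y, ξ.2) ∈ prodCone F ∧ ∑ r, y r = ∑ r, ξ.1 r ∧
      dsq w q (y, ξ.2) ≤ mu F w (invW W) *
        (wnormSq (invW W) (∑ r, q.1 r - ∑ r, ξ.1 r) + ∑ r, (q.2 r - ξ.2 r) ^ 2) := by
  obtain ⟨y, hy, hs, hb⟩ := exists_dualSolution_sum_sq_le hsub h0 hq hξ
  refine ⟨y, hy, hs, ?_⟩
  set T := ∑ i, w i
  set D := ∑ r, (q.2 r - ξ.2 r) ^ 2 with hD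
  set u := wnormSq (invW W) (∑ r, q.1 r - ∑ r, ξ.1 r) with hu
  have hDn : 0 ≤ D := Finset.sum_nonneg fun _ _ => sq_nonneg _
  have hTn : 0 ≤ T := Finset.sum_nonneg fun i _ => hw i
  have hun : 0 ≤ u := Finset.sum_nonneg fun i _ =>
    mul_nonneg (inv_pos.2 (hW i)).le (sq_nonneg _)
  have h1 : ∑ r, wnormSq w (q.1 r - y r) ≤
      T * ((∑ j, W j) * u + rho F ^ 2 * D) := by
    simp only [wnormSq]
    rw [Finset.sum_comm, Finset.sum_mul]
    refine Finset.sum_le_sum fun i _ => ?_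
    rw [← Finset.mul_sum]
    refine mul_le_mul_of_nonneg_left ((hb i).trans (add_le_add ?_ le_rfl)) (hw i)
    refine (sq_sum_abs_le hW _).trans (le_of_eq ?_)
    rw [hu, wnormSq]
    simp [invW]
  have h2 : T * ∑ j, W j ≤ mu F w (invW W) := by
    refine le_trans (le_of_eq ?_) (le_max_left _ _)
    simp [invW, T]
  -- Only `rho F ^ 2 * T + 1` is needed as the coefficient of `D`, the `+ 1` coming from the
  -- `φ`-components; the rest of the factor `9 / 4` is slack.
  have h3 : 9 / 4 * rho F ^ 2 * T + 1 ≤ mu F w (invW W) := le_max_right _ _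
  have h4 := mul_le_mul_of_nonneg_right h2 hun
  have h5 := mul_le_mul_of_nonneg_right h3 hDn
  have h6 : 0 ≤ rho F ^ 2 * T * D := by positivity
  rw [dsq]
  nlinarith

/-! ### Orthogonal projection onto `𝒵` -/

open Classical in
/-- Projection onto the affine set `{∑ y_r = s, φ = φs, y supported}`. -/
noncomputable def projZ (F : Fin R → Finset (Fin N) → ℝ) (s : Fin N → ℝ) (φs : Fin R → ℝ)
    (q : Pt N R) : Pt N R :=
  (fun r i => q.1 r i -
    if i ∈ support (F r) then (Psi F i)⁻¹ * (∑ r, q.1 r i - s i) else 0, φs)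

theorem projZ_mem {F : Fin R → Finset (Fin N) → ℝ} (hinc : ∀ i, ∃ r, i ∈ support (F r))
    {W a xs : Fin N → ℝ} {φs : Fin R → ℝ} {q : Pt N R}
    (hq : ∀ r i, i ∉ support (F r) → q.1 r i = 0) :
    projZ F ((2 : ℝ) • (W * (a - xs))) φs q ∈ affineZ F W a xs φs := by
  classical
  refine ⟨?_, fun r => rfl, fun r i hi => by simp [projZ, hi, hq r i hi]⟩
  ext i
  simp only [Finset.sum_apply, projZ, Finset.sum_sub_distrib, sum_ite_support]
  rw [mul_inv_cancel_left₀ (Psi_pos hinc i).ne', sub_sub_cancel]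

theorem dsq_projZ {F : Fin R → Finset (Fin N) → ℝ} (hinc : ∀ i, ∃ r, i ∈ support (F r))
    (W s : Fin N → ℝ) (φs : Fin R → ℝ) (q : Pt N R) :
    dsq (PsiInvW F W) q (projZ F s φs q) =
      wnormSq (invW W) (∑ r, q.1 r - s) + ∑ r, (q.2 r - φs r) ^ 2 := by
  classical
  rw [dsq]
  congr 1
  simp only [wnormSq]
  rw [Finset.sum_comm]
  refine Finset.sum_congr rfl fun i _ => ?_
  have e : ∀ r, PsiInvW F W i * (q.1 r - (projZ F s φs q).1 r) i ^ 2 =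
      if i ∈ support (F r) then
        PsiInvW F W i * ((Psi F i)⁻¹ * (∑ r, q.1 r i - s i)) ^ 2 else 0 := by
    intro r
    simp only [projZ, Pi.sub_apply, sub_sub_cancel]
    split_ifs <;> simp
  rw [Finset.sum_congr rfl fun r _ => e r, sum_ite_support]
  have := (Psi_pos hinc i).ne'
  simp only [PsiInvW, invW, Pi.sub_apply, Finset.sum_apply]
  field_simp

/-- Pythagoras: in the `Ψ W⁻¹` inner product the `y`-part of the correction has the same weighted
coefficient in every incident component, so it is orthogonal to supported differences with zero sum,
and on `𝒵` the `φ`-components agree. -/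
theorem dsq_eq_dsq_projZ_add {F : Fin R → Finset (Fin N) → ℝ}
    (hinc : ∀ i, ∃ r, i ∈ support (F r)) {W a xs : Fin N → ℝ} {φs : Fin R → ℝ} {q ζ : Pt N R}
    (hq : ∀ r i, i ∉ support (F r) → q.1 r i = 0) (hζ : ζ ∈ affineZ F W a xs φs) :
    dsq (PsiInvW F W) q ζ =
      dsq (PsiInvW F W) q (projZ F ((2 : ℝ) • (W * (a - xs))) φs q) +
        dsq (PsiInvW F W) (projZ F ((2 : ℝ) • (W * (a - xs))) φs q) ζ := by
  classical
  have hz := projZ_mem hinc (W := W) (a := a) (xs := xs) (φs := φs) hq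
  set z := projZ F ((2 : ℝ) • (W * (a - xs))) φs q with hzdef
  rw [dsq_eq_add _ q z ζ, add_eq_left, mul_eq_zero]
  right
  have h2 : ∑ r, (q - z).2 r * (z - ζ).2 r = 0 :=
    Finset.sum_eq_zero fun r _ => by
      have : (z - ζ).2 r = 0 := sub_eq_zero.2 ((hz.2.1 r).trans (hζ.2.1 r).symm)
      rw [this, mul_zero]
  rw [dinner, h2, add_zero, Finset.sum_comm]
  refine Finset.sum_eq_zero fun i _ => ?_
  have e : ∀ r, PsiInvW F W i * ((q - z).1 r i * (z - ζ).1 r i) =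
      PsiInvW F W i * ((Psi F i)⁻¹ * (∑ r, q.1 r i - ((2 : ℝ) • (W * (a - xs))) i)) *
        (z.1 r i - ζ.1 r i) := by
    intro r
    by_cases hi : i ∈ support (F r)
    · have : (q - z).1 r i =
          (Psi F i)⁻¹ * (∑ r, q.1 r i - ((2 : ℝ) • (W * (a - xs))) i) := by
        simp [hzdef, projZ, hi]
      rw [this]
      simp only [Prod.fst_sub, Pi.sub_apply]
      ring
    · simp [hz.2.2 r i hi, hζ.2.2 r i hi]
  rw [Finset.sum_congr rfl fun r _ => e r, ← Finset.mul_sum, Finset.sum_sub_distrib]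
  have e1 := congrFun hz.1 i
  have e2 := congrFun hζ.1 i
  simp only [Finset.sum_apply] at e1 e2
  rw [e1, e2, sub_self, mul_zero]

/-! ### Distances to sets -/

theorem wdist_le {w : Fin N → ℝ} {p q : Pt N R} {S : Set (Pt N R)} (hq : q ∈ S) :
    wdist w p S ≤ ENNReal.ofReal (Real.sqrt (dsq w p q)) := iInf₂_le q hq

theorem wdist_self {w : Fin N → ℝ} {p : Pt N R} {S : Set (Pt N R)} (hp : p ∈ S) :
    wdist w p S = 0 := by
  have := wdist_le (w := w) (p := p) hp
  simpa [dsq, wnormSq] using this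

theorem wdist_eq_of_isMinOn {w : Fin N → ℝ} {p ξ : Pt N R} {S : Set (Pt N R)} (hξ : ξ ∈ S)
    (h : ∀ ζ ∈ S, dsq w p ξ ≤ dsq w p ζ) :
    wdist w p S = ENNReal.ofReal (Real.sqrt (dsq w p ξ)) :=
  le_antisymm (wdist_le hξ) (le_iInf₂ fun ζ hζ =>
    ENNReal.ofReal_le_ofReal (Real.sqrt_le_sqrt (h ζ hζ)))

/-- A pointwise comparison of squared distances gives one of distances to sets. -/
theorem wdist_le_mul_wdist {w : Fin N → ℝ} {p : Pt N R} {S T : Set (Pt N R)}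
    {K : ℝ} (hK : 0 < K) (h : ∀ q ∈ T, ∃ ξ ∈ S, dsq w p ξ ≤ K ^ 2 * dsq w p q) :
    wdist w p S ≤ ENNReal.ofReal K * wdist w p T := by
  have hK' : ENNReal.ofReal K ≠ 0 := by simpa using hK
  rw [mul_comm, ← ENNReal.div_le_iff hK' ENNReal.ofReal_ne_top]
  refine le_iInf₂ fun q hq => ?_
  obtain ⟨ξ, hξ, hle⟩ := h q hq
  rw [ENNReal.div_le_iff hK' ENNReal.ofReal_ne_top]
  refine (wdist_le hξ).trans ?_
  rw [mul_comm, ← ENNReal.ofReal_mul hK.le]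
  refine ENNReal.ofReal_le_ofReal ((Real.sqrt_le_sqrt hle).trans ?_)
  rw [Real.sqrt_mul (sq_nonneg K), Real.sqrt_sq hK.le, dsq]

theorem continuous_dsq (w : Fin N → ℝ) (p : Pt N R) : Continuous fun q => dsq w p q := by
  simp only [dsq, wnormSq, Pi.sub_apply]
  fun_prop

/-! ### Error bound and contraction of one step -/

section Solution

variable {F : Fin R → Finset (Fin N) → ℝ} {W a xs : Fin N → ℝ} {ξ₀ : Pt N R}

theorem exists_nearest_dualSolution (hsub : ∀ r, IsSubmodular (F r)) (h0 : ∀ r, F r ∅ = 0)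
    (hW : ∀ i, 0 < W i) (hxs : IsPrimalSolution F W a xs) (hf : ∀ r, 0 ≤ lovasz (F r) xs)
    (hξ₀ : ξ₀ ∈ dualSolutions F W a) (w : Fin N → ℝ) (p : Pt N R) :
    ∃ ξ ∈ dualSolutions F W a, ∀ ζ ∈ dualSolutions F W a, dsq w p ξ ≤ dsq w p ζ := by
  -- With `φ` and the sum fixed, `Ξ` is a copy of a compact set of decompositions, so nearest points
  -- exist.
  have himg : dualSolutions F W a = (fun y : Fin R → Fin N → ℝ => ((y, ξ₀.2) : Pt N R)) ''
      decompositions (fun r => ξ₀.2 r • F r) ((2 : ℝ) • (W * (a - xs))) := by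
    ext q
    rw [mem_dualSolutions_iff hsub h0 hW hxs hf hξ₀]
    constructor
    · rintro ⟨hq, hs, hφ, -⟩
      refine ⟨q.1, ⟨fun r => ?_, hs⟩, Prod.ext rfl (funext fun r => (hφ r).symm)⟩
      have := ((mem_coneOf_iff (hsub r) (h0 r)).1 (hq r)).2
      rwa [hφ r] at this
    · rintro ⟨y, hy, rfl⟩
      have hc : ((y, ξ₀.2) : Pt N R) ∈ prodCone F := fun r =>
        (mem_coneOf_iff (hsub r) (h0 r)).2 ⟨(hξ₀.1 r).1, hy.1 r⟩
      exact ⟨hc, hy.2, fun r => rfl, fun r i hi => eq_zero_of_mem_coneOf (h0 r) (hc r) hi⟩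
  have hK : IsCompact (dualSolutions F W a) := by
    rw [himg]
    exact (isCompact_decompositions _ _).image (by fun_prop)
  obtain ⟨ξ, hξ, h⟩ := hK.exists_isMinOn ⟨ξ₀, hξ₀⟩ (continuous_dsq w p).continuousOn
  exact ⟨ξ, hξ, fun ζ hζ => h hζ⟩

/-- Error bound: the distance to the solution set is controlled by the distances to the cone and
to the affine set. -/
theorem error_bound (hsub : ∀ r, IsSubmodular (F r)) (h0 : ∀ r, F r ∅ = 0)
    (hinc : ∀ i, ∃ r, i ∈ support (F r)) (hW : ∀ i, 0 < W i)
    (hxs : IsPrimalSolution F W a xs) (hf : ∀ r, 0 ≤ lovasz (F r) xs)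
    (hξ₀ : ξ₀ ∈ dualSolutions F W a) {p : Pt N R}
    (hp : p ∈ prodCone F ∪ affineZ F W a xs ξ₀.2) :
    wdist (PsiInvW F W) p (dualSolutions F W a) ≤
      ENNReal.ofReal (Real.sqrt (1 + mu F (PsiInvW F W) (invW W))) *
        max (wdist (PsiInvW F W) p (prodCone F))
          (wdist (PsiInvW F W) p (affineZ F W a xs ξ₀.2)) := by
  have hw : ∀ i, 0 ≤ PsiInvW F W i := fun i => (PsiInvW_pos hinc hW i).le
  have hmu : 1 ≤ mu F (PsiInvW F W) (invW W) := one_le_mu hw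
  set m := mu F (PsiInvW F W) (invW W) with hm
  have hK : 0 < Real.sqrt (1 + m) := Real.sqrt_pos.2 (by linarith)
  have hK2 : Real.sqrt (1 + m) ^ 2 = 1 + m := Real.sq_sqrt (by linarith)
  have hs₀ := sum_eq_of_mem_dualSolutions hsub h0 hW hxs hf hξ₀
  set s := (2 : ℝ) • (W * (a - xs)) with hs
  have hnear : ∀ q ∈ prodCone F, ∃ ξ ∈ dualSolutions F W a, dsq (PsiInvW F W) q ξ ≤
      m * dsq (PsiInvW F W) q (projZ F s ξ₀.2 q) := by
    intro q hq
    obtain ⟨y, hy, hys, hle⟩ := exists_dualSolution_dsq_le hsub h0 hW hw hq hξ₀.1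
    refine ⟨(y, ξ₀.2), ?_, ?_⟩
    · exact (mem_dualSolutions_iff hsub h0 hW hxs hf hξ₀).2 ⟨hy, hys.trans hs₀, fun r => rfl,
        fun r i hi => eq_zero_of_mem_coneOf (h0 r) (hy r) hi⟩
    · rwa [dsq_projZ hinc, ← hs₀]
  have hsupp : ∀ q ∈ prodCone F, ∀ r i, i ∉ support (F r) → q.1 r i = 0 := fun q hq r i hi =>
    eq_zero_of_mem_coneOf (h0 r) (hq r) hi
  rcases hp with hp | hp
  · refine le_trans (wdist_le_mul_wdist (T := affineZ F W a xs ξ₀.2) hK fun ζ hζ => ?_)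
      (mul_le_mul' le_rfl (le_max_right _ _))
    obtain ⟨ξ, hξ, hle⟩ := hnear p hp
    refine ⟨ξ, hξ, hle.trans ?_⟩
    have h1 := dsq_eq_dsq_projZ_add hinc (hsupp p hp) hζ
    have h2 := dsq_nonneg hw (projZ F s ξ₀.2 p) ζ
    have h3 := dsq_nonneg hw p (projZ F s ξ₀.2 p)
    rw [hK2, h1, ← hs]
    nlinarith
  · refine le_trans (wdist_le_mul_wdist (T := prodCone F) hK fun q hq => ?_)
      (mul_le_mul' le_rfl (le_max_left _ _))
    obtain ⟨ξ, hξ, hle⟩ := hnear q hq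
    refine ⟨ξ, hξ, ?_⟩
    set z := projZ F s ξ₀.2 q with hz
    have h1 : dsq (PsiInvW F W) q p = dsq (PsiInvW F W) q z + dsq (PsiInvW F W) z p :=
      dsq_eq_dsq_projZ_add hinc (hsupp q hq) hp
    have h2 : dsq (PsiInvW F W) q ξ = dsq (PsiInvW F W) q z + dsq (PsiInvW F W) z ξ :=
      dsq_eq_dsq_projZ_add hinc (hsupp q hq)
        ((mem_dualSolutions_iff hsub h0 hW hxs hf hξ₀).1 hξ).2
    have h3 := dsq_young hw (by linarith : 0 < m) p z ξ
    have h4 : dsq (PsiInvW F W) p q = dsq (PsiInvW F W) q p := dsq_comm _ _ _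
    have h5 : dsq (PsiInvW F W) p z = dsq (PsiInvW F W) z p := dsq_comm _ _ _
    have h6 := dsq_nonneg hw z p
    have h7 := dsq_nonneg hw q z
    have h8 : 1 + m⁻¹ ≤ 1 + m := by
      have := inv_le_one_of_one_le₀ hmu
      linarith
    -- Young's parameter `m` is chosen so that `(1 + m⁻¹) * m = 1 + m`; the two terms then recombine
    -- by Pythagoras into `(1 + m)` times the squared distance from `p` to `q`.
    have h9 : (1 + m⁻¹) * dsq (PsiInvW F W) z ξ ≤ (1 + m) * dsq (PsiInvW F W) q z := by
      have h10 : dsq (PsiInvW F W) z ξ ≤ m * dsq (PsiInvW F W) q z := by linarith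
      refine (mul_le_mul_of_nonneg_left h10 (by positivity)).trans (le_of_eq ?_)
      field_simp
      ring
    rw [hK2, h4, h1, mul_add]
    rw [h5] at h3
    linarith

/-- Variational inequality of the projection step. -/
theorem projection_first_order {F : Finset (Fin N) → ℝ} (hF : IsSubmodular F) (h0 : F ∅ = 0)
    {w l : Fin N → ℝ} {b c : (Fin N → ℝ) × ℝ} (hb : b ∈ coneOf F)
    (hmin : ∀ c ∈ coneOf F, wnormSq w (b.1 - l) + b.2 ^ 2 ≤ wnormSq w (c.1 - l) + c.2 ^ 2)
    (hc : c ∈ coneOf F) :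
    0 ≤ ∑ i, w i * ((b.1 i - l i) * (c.1 i - b.1 i)) + b.2 * (c.2 - b.2) := by
  have h := nonneg_of_forall_quadratic
    (L := 2 * (∑ i, w i * ((b.1 i - l i) * (c.1 i - b.1 i)) + b.2 * (c.2 - b.2)))
    (Q := ∑ i, w i * (c.1 i - b.1 i) ^ 2 + (c.2 - b.2) ^ 2) fun t ht ht1 => by
      have h1 := hmin _ (coneOf_add_smul hF h0 hb hc (sub_nonneg.2 ht1) ht.le)
      have e : wnormSq w (((1 - t) • b + t • c).1 - l) = wnormSq w (b.1 - l) +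
          2 * t * (∑ i, w i * ((b.1 i - l i) * (c.1 i - b.1 i))) +
          t ^ 2 * ∑ i, w i * (c.1 i - b.1 i) ^ 2 := by
        simp only [wnormSq, Finset.mul_sum, ← Finset.sum_add_distrib]
        refine Finset.sum_congr rfl fun i _ => ?_
        simp
        ring
      have e2 : ((1 - t) • b + t • c).2 = b.2 + t * (c.2 - b.2) := by
        simp
        ring
      rw [e, e2] at h1
      nlinarith
  linarith

/-- One step of the method moves the projection onto the affine set firmly towards every dual
solution. -/
theorem dsq_step_le (hsub : ∀ r, IsSubmodular (F r)) (h0 : ∀ r, F r ∅ = 0)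
    (hinc : ∀ i, ∃ r, i ∈ support (F r)) (hW : ∀ i, 0 < W i)
    (hxs : IsPrimalSolution F W a xs) (hf : ∀ r, 0 ≤ lovasz (F r) xs)
    {ξ : Pt N R} (hξ : ξ ∈ dualSolutions F W a) {p b : Pt N R} (hb : ∀ r,
      (b.1 r, b.2 r) ∈ coneOf (F r) ∧ ∀ c ∈ coneOf (F r),
        wnormSq (PsiInvW F W) (b.1 r - apLam F W a p r) + b.2 r ^ 2 ≤
          wnormSq (PsiInvW F W) (c.1 - apLam F W a p r) + c.2 ^ 2) :
    dsq (PsiInvW F W) b ξ +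
        dsq (PsiInvW F W) (projZ F ((2 : ℝ) • (W * (a - xs))) ξ.2 p) b ≤
      dsq (PsiInvW F W) (projZ F ((2 : ℝ) • (W * (a - xs))) ξ.2 p) ξ := by
  classical
  set z := projZ F ((2 : ℝ) • (W * (a - xs))) ξ.2 p with hz
  have hbC : b ∈ prodCone F := fun r => (hb r).1
  have hA := Finset.sum_nonneg fun r (_ : r ∈ Finset.univ) =>
    projection_first_order (hsub r) (h0 r) (hb r).1 (hb r).2 (hξ.1 r)
  have hB := dual_first_order hsub h0 hW hξ hbC
  rw [primalOf_eq hsub h0 hW hxs hf hξ] at hB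
  rw [dsq_eq_add _ z b ξ]
  suffices 0 ≤ dinner (PsiInvW F W) (z - b) (b - ξ) by linarith
  refine (add_nonneg hA hB).trans (le_of_eq ?_)
  rw [dinner, ← Finset.sum_add_distrib, ← Finset.sum_add_distrib]
  refine Finset.sum_congr rfl fun r _ => ?_
  -- On the support `λ_r - z_r = 2 Ψ⁻¹ W x*`, which the weight `Ψ W⁻¹` turns into `2 x*`: exactly
  -- the linear term in the optimality condition of `ξ`.
  have e : ∀ i, PsiInvW F W i * ((z - b).1 r i * (b - ξ).1 r i) =
      PsiInvW F W i * ((b.1 r i - apLam F W a p r i) * (ξ.1 r i - b.1 r i)) -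
        2 * (xs i * (b.1 r i - ξ.1 r i)) := by
    intro i
    by_cases hi : i ∈ support (F r)
    · have h1 := (Psi_pos hinc i).ne'
      have h2 := (hW i).ne'
      simp only [hz, projZ, apLam, apAlpha, hi, if_true, PsiInvW, Prod.fst_sub, Pi.sub_apply,
        Pi.smul_apply, Pi.mul_apply, smul_eq_mul]
      field_simp
      ring
    · have h1 : b.1 r i = 0 := eq_zero_of_mem_coneOf (h0 r) (hbC r) hi
      have h2 : ξ.1 r i = 0 := eq_zero_of_mem_coneOf (h0 r) (hξ.1 r) hi
      simp [h1, h2]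
  rw [Finset.sum_congr rfl fun i _ => e i, Finset.sum_sub_distrib, ← Finset.mul_sum]
  simp only [hz, projZ, Prod.snd_sub, Pi.sub_apply]
  ring

/-- An error bound with constant `K` makes one step of the method a contraction. -/
theorem wdist_step_le (hsub : ∀ r, IsSubmodular (F r)) (h0 : ∀ r, F r ∅ = 0)
    (hinc : ∀ i, ∃ r, i ∈ support (F r)) (hW : ∀ i, 0 < W i)
    (hxs : IsPrimalSolution F W a xs) (hf : ∀ r, 0 ≤ lovasz (F r) xs)
    (hξ₀ : ξ₀ ∈ dualSolutions F W a) {K : ℝ} (hK : 0 < K)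
    (hbound : ∀ p ∈ prodCone F ∪ affineZ F W a xs ξ₀.2,
      wdist (PsiInvW F W) p (dualSolutions F W a) ≤ ENNReal.ofReal K *
        max (wdist (PsiInvW F W) p (prodCone F))
          (wdist (PsiInvW F W) p (affineZ F W a xs ξ₀.2)))
    {p b : Pt N R} (hp : p ∈ prodCone F) (hb : ∀ r,
      (b.1 r, b.2 r) ∈ coneOf (F r) ∧ ∀ c ∈ coneOf (F r),
        wnormSq (PsiInvW F W) (b.1 r - apLam F W a p r) + b.2 r ^ 2 ≤
          wnormSq (PsiInvW F W) (c.1 - apLam F W a p r) + c.2 ^ 2) :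
    wdist (PsiInvW F W) b (dualSolutions F W a) ≤
      wdist (PsiInvW F W) p (dualSolutions F W a) * ENNReal.ofReal (1 - 1 / K ^ 2) := by
  have hw : ∀ i, 0 ≤ PsiInvW F W i := fun i => (PsiInvW_pos hinc hW i).le
  have hiff {q : Pt N R} := mem_dualSolutions_iff hsub h0 hW hxs hf hξ₀ (p := q)
  have hbC : b ∈ prodCone F := fun r => (hb r).1
  have hpsupp : ∀ r i, i ∉ support (F r) → p.1 r i = 0 := fun r i hi =>
    eq_zero_of_mem_coneOf (h0 r) (hp r) hi
  have hzZ := projZ_mem hinc (W := W) (a := a) (xs := xs) (φs := ξ₀.2) hpsupp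
  obtain ⟨ξ, hξ, hξmin⟩ :=
    exists_nearest_dualSolution hsub h0 hW hxs hf hξ₀ (PsiInvW F W) p
  have hpz := dsq_eq_dsq_projZ_add hinc hpsupp (hiff.1 hξ).2
  set z := projZ F ((2 : ℝ) • (W * (a - xs))) ξ₀.2 p with hz
  obtain ⟨ζ, hζ, hζmin⟩ :=
    exists_nearest_dualSolution hsub h0 hW hxs hf hξ₀ (PsiInvW F W) z
  have hdp := wdist_eq_of_isMinOn hξ hξmin
  have hdz := wdist_eq_of_isMinOn hζ hζmin
  have hstep := dsq_step_le hsub h0 hinc hW hxs hf hζ hb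
  have hζ2 : ζ.2 = ξ₀.2 := funext (hiff.1 hζ).2.2.1
  rw [hζ2, ← hz] at hstep
  have toReal : ∀ {u v : ℝ}, 0 ≤ v → ENNReal.ofReal (Real.sqrt u) ≤
      ENNReal.ofReal K * ENNReal.ofReal (Real.sqrt v) → u ≤ K ^ 2 * v := by
    intro u v hv h
    rw [← ENNReal.ofReal_mul hK.le, ENNReal.ofReal_le_ofReal_iff (by positivity),
      Real.sqrt_le_left (by positivity), mul_pow, Real.sq_sqrt hv] at h
    exact h
  have h1 : dsq (PsiInvW F W) p ξ ≤ K ^ 2 * dsq (PsiInvW F W) p z := by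
    have := hbound p (Or.inl hp)
    rw [wdist_self hp, max_eq_right (zero_le), hdp] at this
    exact toReal (dsq_nonneg hw _ _) (this.trans (mul_le_mul' le_rfl (wdist_le hzZ)))
  have h2 : dsq (PsiInvW F W) z ζ ≤ K ^ 2 * dsq (PsiInvW F W) z b := by
    have := hbound z (Or.inr hzZ)
    rw [wdist_self hzZ, max_eq_left (zero_le), hdz] at this
    exact toReal (dsq_nonneg hw _ _) (this.trans (mul_le_mul' le_rfl (wdist_le hbC)))
  have h3 := hζmin ξ hξ
  refine (wdist_le hζ).trans ?_
  rw [hdp, ← ENNReal.ofReal_mul (Real.sqrt_nonneg _)]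
  refine ENNReal.ofReal_le_ofReal ?_
  have hK2 : 0 < K ^ 2 := by positivity
  have g1 : dsq (PsiInvW F W) z ξ ≤ (1 - 1 / K ^ 2) * dsq (PsiInvW F W) p ξ := by
    have := (div_le_iff₀' hK2).2 h1
    rw [sub_mul, one_mul, one_div_mul_eq_div]
    linarith
  have g2 : dsq (PsiInvW F W) b ζ ≤ (1 - 1 / K ^ 2) * dsq (PsiInvW F W) z ζ := by
    have := (div_le_iff₀' hK2).2 h2
    rw [sub_mul, one_mul, one_div_mul_eq_div]
    linarith
  have n1 := dsq_nonneg hw p ξ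
  have n2 := dsq_nonneg hw z ξ
  have n3 := dsq_nonneg hw z ζ
  set θ := 1 - 1 / K ^ 2
  rcases le_total 0 θ with hθ | hθ
  · refine Real.sqrt_le_iff.2 ⟨by positivity, ?_⟩
    rw [mul_pow, Real.sq_sqrt n1]
    have h4 := mul_le_mul_of_nonneg_left (h3.trans g1) hθ
    linarith
  -- A negative factor (`K < 1`) is truncated to 0 by `ENNReal.ofReal`; here the bounds already
  -- force the new distance to vanish.
  · have h4 : θ * dsq (PsiInvW F W) p ξ = 0 := by
      have := mul_nonpos_of_nonpos_of_nonneg hθ n1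
      linarith
    have h5 : dsq (PsiInvW F W) b ζ ≤ 0 :=
      g2.trans (mul_nonpos_of_nonpos_of_nonneg hθ n3)
    rw [Real.sqrt_eq_zero_of_nonpos h5]
    rcases mul_eq_zero.1 h4 with h | h <;> simp [h]

theorem wdist_iterate_le (hsub : ∀ r, IsSubmodular (F r)) (h0 : ∀ r, F r ∅ = 0)
    (hinc : ∀ i, ∃ r, i ∈ support (F r)) (hW : ∀ i, 0 < W i)
    (hxs : IsPrimalSolution F W a xs) (hf : ∀ r, 0 ≤ lovasz (F r) xs)
    (hξ₀ : ξ₀ ∈ dualSolutions F W a) {K : ℝ} (hK : 0 < K)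
    (hbound : ∀ p ∈ prodCone F ∪ affineZ F W a xs ξ₀.2,
      wdist (PsiInvW F W) p (dualSolutions F W a) ≤ ENNReal.ofReal K *
        max (wdist (PsiInvW F W) p (prodCone F))
          (wdist (PsiInvW F W) p (affineZ F W a xs ξ₀.2)))
    {p : ℕ → Pt N R} (hp : IsAPSequence F W a p) (k : ℕ) :
    p k ∈ prodCone F ∧ wdist (PsiInvW F W) (p k) (dualSolutions F W a) ≤
      wdist (PsiInvW F W) (p 0) (dualSolutions F W a) *
        ENNReal.ofReal (1 - 1 / K ^ 2) ^ k := by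
  induction k with
  | zero =>
    refine ⟨fun r => ?_, by simp⟩
    rw [hp.1]
    obtain ⟨z, hz⟩ := basePolytope_nonempty (hsub r) (h0 r)
    exact ⟨le_rfl, z, hz, zero_smul _ _⟩
  | succ k ih =>
    refine ⟨fun r => (hp.2 k r).1, ?_⟩
    refine (wdist_step_le hsub h0 hinc hW hxs hf hξ₀ hK hbound ih.1 (hp.2 k)).trans ?_
    rw [pow_succ _ k, ← mul_assoc]
    exact mul_le_mul' ih.2 le_rfl

end Solution

/-! ### The constant `κ_*` -/

section Rate

variable {F : Fin R → Finset (Fin N) → ℝ} {W a xs : Fin N → ℝ} {ξ₀ : Pt N R}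

theorem kappaStar_le (hsub : ∀ r, IsSubmodular (F r)) (h0 : ∀ r, F r ∅ = 0)
    (hinc : ∀ i, ∃ r, i ∈ support (F r)) (hW : ∀ i, 0 < W i)
    (hxs : IsPrimalSolution F W a xs) (hf : ∀ r, 0 ≤ lovasz (F r) xs)
    (hξ₀ : ξ₀ ∈ dualSolutions F W a) :
    kappaStar F W a xs ξ₀.2 ≤ ENNReal.ofReal (Real.sqrt (1 + mu F (PsiInvW F W) (invW W))) :=
  iSup₂_le fun _ hp => ENNReal.div_le_of_le_mul
    (error_bound hsub h0 hinc hW hxs hf hξ₀ hp.1)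

/-- Recovers a product bound from the supremum of quotients. Finiteness of `κ_*` covers a zero
denominator, and points of `Ξ`, excluded from the supremum, satisfy the bound trivially. -/
theorem wdist_le_kappaStar_mul (hsub : ∀ r, IsSubmodular (F r)) (h0 : ∀ r, F r ∅ = 0)
    (hinc : ∀ i, ∃ r, i ∈ support (F r)) (hW : ∀ i, 0 < W i)
    (hxs : IsPrimalSolution F W a xs) (hf : ∀ r, 0 ≤ lovasz (F r) xs)
    (hξ₀ : ξ₀ ∈ dualSolutions F W a) {p : Pt N R}
    (hp : p ∈ prodCone F ∪ affineZ F W a xs ξ₀.2) :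
    wdist (PsiInvW F W) p (dualSolutions F W a) ≤
      ENNReal.ofReal (kappaStar F W a xs ξ₀.2).toReal *
        max (wdist (PsiInvW F W) p (prodCone F))
          (wdist (PsiInvW F W) p (affineZ F W a xs ξ₀.2)) := by
  have hfin : kappaStar F W a xs ξ₀.2 ≠ ∞ :=
    ne_top_of_le_ne_top ENNReal.ofReal_ne_top (kappaStar_le hsub h0 hinc hW hxs hf hξ₀)
  rw [ENNReal.ofReal_toReal hfin]
  by_cases hΞ : p ∈ dualSolutions F W a
  · rw [wdist_self hΞ]
    exact zero_le
  · have hξ := (mem_dualSolutions_iff hsub h0 hW hxs hf hξ₀).1 hξ₀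
    have hmax : max (wdist (PsiInvW F W) p (prodCone F))
        (wdist (PsiInvW F W) p (affineZ F W a xs ξ₀.2)) ≠ ∞ :=
      (max_lt ((wdist_le hξ.1).trans_lt ENNReal.ofReal_lt_top)
        ((wdist_le hξ.2).trans_lt ENNReal.ofReal_lt_top)).ne
    refine (ENNReal.div_le_iff_le_mul (Or.inr hfin) (Or.inl hmax)).1 ?_
    exact le_iSup₂_of_le (f := fun p _ => wdist (PsiInvW F W) p (dualSolutions F W a) /
      max (wdist (PsiInvW F W) p (prodCone F))
        (wdist (PsiInvW F W) p (affineZ F W a xs ξ₀.2))) p ⟨hp, hΞ⟩ le_rfl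

end Rate

/-! ### Comparison of constants and iteration count -/

theorem Psi_le (F : Fin R → Finset (Fin N) → ℝ) (i : Fin N) : Psi F i ≤ R := by
  classical
  rw [Psi]
  exact_mod_cast (Finset.card_filter_le _ _).trans (by simp)

theorem sum_PsiInvW_le (F : Fin R → Finset (Fin N) → ℝ) {W : Fin N → ℝ} (hW : ∀ i, 0 < W i) :
    ∑ i, PsiInvW F W i ≤ R * ∑ i, invW W i := by
  rw [Finset.mul_sum]
  exact Finset.sum_le_sum fun i _ =>
    mul_le_mul_of_nonneg_right (Psi_le F i) (inv_pos.2 (hW i)).le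

theorem mu_PsiInvW_le (hR : 0 < R) (F : Fin R → Finset (Fin N) → ℝ) {W : Fin N → ℝ}
    (hW : ∀ i, 0 < W i) :
    mu F (PsiInvW F W) (invW W) ≤ R * mu F (invW W) (invW W) := by
  have hR1 : (1 : ℝ) ≤ R := by exact_mod_cast hR
  have h := sum_PsiInvW_le F hW
  have hn : 0 ≤ ∑ j, 1 / invW W j :=
    Finset.sum_nonneg fun j _ => by simpa [invW] using (hW j).le
  refine max_le ?_ ?_
  · have h1 := mul_le_mul_of_nonneg_right h hn
    rw [mul_assoc] at h1
    exact h1.trans (mul_le_mul_of_nonneg_left (le_max_left _ _) (by positivity))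
  · have h1 := mul_le_mul_of_nonneg_left h (by positivity : 0 ≤ 9 / 4 * rho F ^ 2)
    have h2 := mul_le_mul_of_nonneg_left (le_max_right ((∑ i, invW W i) * ∑ j, 1 / invW W j)
      (9 / 4 * rho F ^ 2 * (∑ i, invW W i) + 1)) (by positivity : (0 : ℝ) ≤ R)
    rw [mu]
    linarith

theorem mul_pow_le_of_log_le {m d ε : ℝ} (hm : 1 ≤ m) (hd : 0 ≤ d) (hε : 0 < ε) {k : ℕ}
    (hk : m * Real.log (2 * d / ε) ≤ k) : 2 * d * (1 - 1 / m) ^ k ≤ ε := by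
  -- For `d = 0` the hypothesis carries no information, since `Real.log 0 = 0`, but the conclusion
  -- is immediate.
  rcases hd.eq_or_lt with rfl | hd
  · simpa using hε.le
  have hm0 : 0 < m := by linarith
  have h1 : 1 - 1 / m ≤ Real.exp (-(1 / m)) := by
    have := Real.add_one_le_exp (-(1 / m))
    linarith
  have h2 : 0 ≤ 1 - 1 / m := sub_nonneg.2 ((div_le_one hm0).2 hm)
  have h3 : (1 - 1 / m) ^ k ≤ Real.exp (-(k / m)) := by
    refine (pow_le_pow_left₀ h2 h1 k).trans (le_of_eq ?_)
    rw [← Real.exp_nat_mul]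
    congr 1
    ring
  have h4 : Real.log (2 * d / ε) ≤ k / m := by
    rw [le_div_iff₀ hm0, mul_comm]
    exact hk
  have h5 : 2 * d / ε ≤ Real.exp (k / m) := (Real.log_le_iff_le_exp (by positivity)).1 h4
  rw [Real.exp_neg] at h3
  have h6 : 2 * d ≤ ε * Real.exp (k / m) := by
    rw [div_le_iff₀ hε] at h5
    linarith
  calc 2 * d * (1 - 1 / m) ^ k ≤ 2 * d * (Real.exp (k / m))⁻¹ :=
        mul_le_mul_of_nonneg_left h3 (by positivity)
    _ ≤ ε := by
        rw [← div_eq_mul_inv]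
        exact (div_le_iff₀ (Real.exp_pos _)).2 h6

end QDSFM

/-! ### The main theorem -/

theorem lemmaC3 {N R : ℕ} (hR : 0 < R)
    (F : Fin R → Finset (Fin N) → ℝ)
    (hsub : ∀ r, QDSFM.IsSubmodular (F r))
    (hnorm : ∀ r, F r ∅ = 0)
    (hnonneg : ∀ r S, 0 ≤ F r S)
    (hinc : ∀ i, ∃ r, i ∈ QDSFM.support (F r))
    (W a : Fin N → ℝ) (hW : ∀ i, 0 < W i)
    (xs : Fin N → ℝ) (hxs : QDSFM.IsPrimalSolution F W a xs)
    (hf : ∀ r, 0 ≤ QDSFM.lovasz (F r) xs)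
    (φs : Fin R → ℝ) (hφs : ∃ y L, QDSFM.IsApproxSolution F W a (y, φs) L) :
    -- the bound on the relative-distance constant
    QDSFM.kappaStar F W a xs φs ^ 2 ≤
        ENNReal.ofReal (1 + QDSFM.mu F (QDSFM.PsiInvW F W) (QDSFM.invW W)) ∧
    -- linear convergence of alternating projection and its iteration count
    (∀ p : ℕ → QDSFM.Pt N R, QDSFM.IsAPSequence F W a p →
      (∀ k : ℕ,
        QDSFM.wdist (QDSFM.PsiInvW F W) (p k) (QDSFM.dualSolutions F W a) ≤
          2 * QDSFM.wdist (QDSFM.PsiInvW F W) (p 0) (QDSFM.dualSolutions F W a) *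
            ENNReal.ofReal (1 - 1 / (QDSFM.kappaStar F W a xs φs).toReal ^ 2) ^ k) ∧
      (∀ k : ℕ,
        QDSFM.wdist (QDSFM.PsiInvW F W) (p k) (QDSFM.dualSolutions F W a) ≤
          2 * QDSFM.wdist (QDSFM.PsiInvW F W) (p 0) (QDSFM.dualSolutions F W a) *
            ENNReal.ofReal
              (1 - 1 / (1 + QDSFM.mu F (QDSFM.PsiInvW F W) (QDSFM.invW W))) ^ k) ∧
      (∀ ε : ℝ, 0 < ε → ∀ k : ℕ,
        (1 + QDSFM.mu F (QDSFM.PsiInvW F W) (QDSFM.invW W)) *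
          Real.log (2 * (QDSFM.wdist (QDSFM.PsiInvW F W) (p 0)
            (QDSFM.dualSolutions F W a)).toReal / ε) ≤ k →
        QDSFM.wdist (QDSFM.PsiInvW F W) (p k) (QDSFM.dualSolutions F W a) ≤
          ENNReal.ofReal ε)) ∧
    -- comparison with the constants in the iteration count of randomized coordinate descent
    QDSFM.mu F (QDSFM.PsiInvW F W) (QDSFM.invW W) ≤
        R * QDSFM.mu F (QDSFM.invW W) (QDSFM.invW W) ∧
    1 + QDSFM.mu F (QDSFM.PsiInvW F W) (QDSFM.invW W) ≤
        R * (1 + QDSFM.mu F (QDSFM.invW W) (QDSFM.invW W)) := by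
  obtain ⟨y, L, hL⟩ := hφs
  have hξ : ((y, φs) : QDSFM.Pt N R) ∈ QDSFM.dualSolutions F W a :=
    QDSFM.mem_dualSolutions_of_isApproxSolution hnorm hinc hW hL
  have hmu : 1 ≤ QDSFM.mu F (QDSFM.PsiInvW F W) (QDSFM.invW W) :=
    QDSFM.one_le_mu fun i => (QDSFM.PsiInvW_pos hinc hW i).le
  have hκ := QDSFM.kappaStar_le hsub hnorm hinc hW hxs hf hξ
  have hcmp := QDSFM.mu_PsiInvW_le hR F hW
  have hsqrt : 0 < Real.sqrt (1 + QDSFM.mu F (QDSFM.PsiInvW F W) (QDSFM.invW W)) :=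
    Real.sqrt_pos.2 (by linarith)
  have hsq := Real.sq_sqrt
    (by linarith : 0 ≤ 1 + QDSFM.mu F (QDSFM.PsiInvW F W) (QDSFM.invW W))
  refine ⟨?_, fun p hp => ?_, hcmp, ?_⟩
  · refine (pow_le_pow_left' hκ 2).trans (le_of_eq ?_)
    rw [← ENNReal.ofReal_pow hsqrt.le, hsq]
  · have hdouble : ∀ d x : ℝ≥0∞, d * x ≤ 2 * d * x := fun d x =>
      mul_le_mul' (le_mul_of_one_le_left' one_le_two) le_rfl
    have hrate : ∀ k, QDSFM.wdist (QDSFM.PsiInvW F W) (p k) (QDSFM.dualSolutions F W a) ≤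
        2 * QDSFM.wdist (QDSFM.PsiInvW F W) (p 0) (QDSFM.dualSolutions F W a) *
          ENNReal.ofReal
            (1 - 1 / (1 + QDSFM.mu F (QDSFM.PsiInvW F W) (QDSFM.invW W))) ^ k := by
      intro k
      have := (QDSFM.wdist_iterate_le hsub hnorm hinc hW hxs hf hξ hsqrt
        (fun q hq => QDSFM.error_bound hsub hnorm hinc hW hxs hf hξ hq) hp k).2
      rw [hsq] at this
      exact this.trans (hdouble _ _)
    have hone : 0 ≤ 1 - 1 / (1 + QDSFM.mu F (QDSFM.PsiInvW F W) (QDSFM.invW W)) :=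
      sub_nonneg.2 ((div_le_one (by linarith)).2 (by linarith))
    refine ⟨fun k => ?_, hrate, fun ε hε k hk => ?_⟩
    -- If `κ_* = 0`, the convention `1 / 0 = 0` makes the factor 1, and the bound follows from the
    -- rate with `1 + μ`.
    · rcases (ENNReal.toReal_nonneg (a := QDSFM.kappaStar F W a xs φs)).eq_or_lt with h | h
      · refine (hrate k).trans (mul_le_mul' le_rfl (pow_le_pow_left' ?_ k))
        refine ENNReal.ofReal_le_ofReal ?_
        rw [← h]
        have : 0 < 1 + QDSFM.mu F (QDSFM.PsiInvW F W) (QDSFM.invW W) := by linarith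
        simpa using this.le
      · exact (QDSFM.wdist_iterate_le hsub hnorm hinc hW hxs hf hξ h
          (fun q hq => QDSFM.wdist_le_kappaStar_mul hsub hnorm hinc hW hxs hf hξ hq)
          hp k).2.trans (hdouble _ _)
    · have hfin : QDSFM.wdist (QDSFM.PsiInvW F W) (p 0) (QDSFM.dualSolutions F W a) ≠ ∞ :=
        ((QDSFM.wdist_le hξ).trans_lt ENNReal.ofReal_lt_top).ne
      refine (hrate k).trans ?_
      have h := QDSFM.mul_pow_le_of_log_le (by linarith) ENNReal.toReal_nonneg hε hk
      refine le_trans (le_of_eq ?_) (ENNReal.ofReal_le_ofReal h)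
      rw [ENNReal.ofReal_mul (by positivity), ENNReal.ofReal_mul (by norm_num),
        ENNReal.ofReal_toReal hfin, ENNReal.ofReal_pow hone, ENNReal.ofReal_ofNat]
  · have hR1 : (1 : ℝ) ≤ R := by exact_mod_cast hR
    rw [mul_add, mul_one]
    exact add_le_add hR1 hcmp
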